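/- **Conventions.** Let $H$ be a commutative multiplicative monoid with more than one element, and let $z(H)=\{z\in H: xz=z\text{ for all }x\in H\}$. $H$ is *cancellative* if every $x\in H\setminus z(H)$ is cancellative. A *weak ideal system* on $H$ is a map $r:\mathbb P(H)\to\mathbb P(H)$, $X\mapsto X_r$, such that for all $X,Y\subseteq H$ and $c\in H$: $XH\cup z(H)\subseteq X_r$; $X\subseteq Y_r$ implies $X_r\subseteq Y_r$; and $cX_r\subseteq (cX)_r$. It is an *ideal system* if always $cX_r=(cX)_r$, and it is *finitary* if $X_r=\bigcup\{E_r: E\subseteq X\text{ finite}\}$ for all $X\subseteq H$. An *$r$-ideal* is a set $I\subseteq H$ with $I_r=I$; $r$ is *modular* if $(I\cup J)_r\cap N\subseteq (I\cup(J\cap N))_r$ for all $r$-ideals $I,J,N$ with $I\subseteq N$. The set $\mathcal I_r(H)$ of $r$-ideals, with inclusion and the $r$-product $(I,J)\mapsto (IJ)_r$ (identity $H$, which is the empty $r$-product), is a multiplicative lattice. An element $y\in H$ is *regular* if it is cancellative and $(yA)_r=yA_r$ for all $A\subseteq H$. An $r$-ideal $I$ is *proper* if $I\ne H$; *nontrivial*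 if $z(H)\subsetneq I$; *regular* if it contains a regular element; *$r$-invertible* if $(IJ)_r=yH$ for some $J\subseteq H$ and some regular $y$; *$r$-finitely generated* if $I=E_r$ for some finite $E\subseteq I$; *prime* if it is proper and $xy\in I$ implies $x\in I$ or $y\in I$; *radical* if $x^n\in I$ with $n\ge 1$ implies $x\in I$. The *radical* of $I$ is $\{x\in H: x^n\in I\text{ for some }n\ge 1\}$. $H$ is an *$r$-SP-monoid* if every $r$-ideal is a finite $r$-product of radical $r$-ideals, and an *$r$-Prüfer monoid* if every regular $r$-finitely generated $r$-ideal is $r$-invertible. An element $p\neq H$ of $\mathcal I_r(H)$ is *$\ell$-prime* if $(IJ)_r\subseteq p$ implies $I\subseteq p$ or $J\subseteq p$ for all $I,J\in\mathcal I_r(H)$; $\dim_r(H)$ is the supremum of the $n$ for which there is a chain $p_0\subsetneq\dots\subsetneq p_n$ of $\ell$-prime elements. $r\text{-}\max^{-1}(H)$ is the set of nontrivial $r$-maximal $r$-ideals (maximal elements among the proper $r$-ideals), with the inverse topology, a basis of whose open sets is given by the sets $\{m: x\subseteq m\}$, $x$ a compact element of the lattice $\mathcal I_r(H)$. (If $H$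 is cancellative, $r$ is an ideal system and some element of $H\setminus z(H)$ is not a unit, then every $r$-maximal $r$-ideal is nontrivial.) For a topological space $X$, $U(X)$ is the monoid of compactly supported upper semicontinuous functions $f:X\to\mathbb N_0$ under pointwise addition, ordered by $f\le_d g$ iff $f(x)\ge g(x)$ for all $x\in X$, and $U_b(X)=U(X)\cup\{b\}$ is obtained by appending a new bottom element $b$ with $b+f=f+b=b$ for all $f\in U_b(X)$. **Corollary 8.5.** Let $H$ be cancellative and let $r$ be a modular finitary ideal system on $H$ with $\emptyset_r\ne H$. The following are equivalent. 1. $H$ is an $r$-SP-monoid. 2. $\dim_r(H)\le 1$ and each $r$-invertible $r$-ideal is a finite $r$-product of radical $r$-ideals. 3. $\dim_r(H)\le 1$ and each nontrivial prime $r$-ideal contains an $r$-invertible radical $r$-ideal. 4. (a) Each $r$-ideal is an $r$-product of radical $r$-ideals $J_1\subseteq\dots\subseteq J_n$; equivalently, (b) each nontrivial $r$-ideal is an $r$-product of proper radical $r$-ideals $J_1\subseteq\dots\subseteq J_n$ (with $n\ge 0$), and $n$ and the $J_i$ are uniquely determined. 5. The radical of each nontrivial $r$-finitely generated $r$-ideal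 is $r$-invertible. 6. $\mathcal I_r(H)$ and $U_b(r\text{-}\max^{-1}(H))$ are isomorphic as multiplicative lattices (there is a bijection that preserves the order in both directions and the multiplication). 7. $H$ is an $r$-Prüfer monoid, and the radical of every $r$-finitely generated $r$-ideal is $r$-finitely generated. -/

import Mathlib

open Pointwise Topology

universe u

/-! ## Monoids -/

/-- The set `z(H)` of zero elements of `H`; it is empty or a singleton. -/
def zeroElements (H : Type u) [CommMonoid H] : Set H :=
  {z | ∀ x : H, x * z = z}

/-- `x` is a cancellative element of `H`. -/
def IsCancellativeElement {H : Type u} [CommMonoid H] (x : H) : Prop :=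
  ∀ y z : H, x * y = x * z → y = z

/-- A monoid is called cancellative if each of its nonzero elements is cancellative. -/
def IsCancellativeMonoid (H : Type u) [CommMonoid H] : Prop :=
  ∀ x : H, x ∉ zeroElements H → IsCancellativeElement x

/-! ## Weak ideal systems -/

/-- A weak ideal system `r : X ↦ X_r` on a commutative monoid `H`; `r.closure X` is `X_r`. -/
structure WeakIdealSystem (H : Type u) [CommMonoid H] where
  /-- the map `X ↦ X_r` -/
  closure : Set H → Set H
  mul_union_zero_subset : ∀ X : Set H, X * Set.univ ∪ zeroElements H ⊆ closure X
  closure_subset : ∀ X Y : Set H, X ⊆ closure Y → closure X ⊆ closure Y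
  smul_closure_subset : ∀ (c : H) (X : Set H), c • closure X ⊆ closure (c • X)

namespace WeakIdealSystem

variable {H : Type u} [CommMonoid H] (r : WeakIdealSystem H)

/-- `r` is an ideal system: `c X_r = (c X)_r`. -/
def IsIdealSystem : Prop :=
  ∀ (c : H) (X : Set H), c • r.closure X = r.closure (c • X)

/-- `r` is finitary: `X_r` is the union of the `E_r`, where `E` is a finite subset of `X`. -/
def IsFinitary : Prop :=
  ∀ X : Set H, r.closure X = ⋃ E ∈ {E : Set H | E ⊆ X ∧ E.Finite}, r.closure E

/-- `I` is an `r`-ideal: `I_r = I`. -/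
def IsRIdeal (I : Set H) : Prop := r.closure I = I

/-- `r` is modular. -/
def IsModular : Prop :=
  ∀ I J N : Set H, r.IsRIdeal I → r.IsRIdeal J → r.IsRIdeal N → I ⊆ N →
    r.closure (I ∪ J) ∩ N ⊆ r.closure (I ∪ (J ∩ N))

theorem subset_closure (X : Set H) : X ⊆ r.closure X := fun x hx =>
  r.mul_union_zero_subset X (Or.inl ⟨x, hx, 1, Set.mem_univ _, mul_one x⟩)

theorem closure_mono {X Y : Set H} (h : X ⊆ Y) : r.closure X ⊆ r.closure Y :=
  r.closure_subset X Y (h.trans (r.subset_closure Y))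

theorem closure_closure (X : Set H) : r.closure (r.closure X) = r.closure X :=
  (r.closure_subset _ _ subset_rfl).antisymm (r.subset_closure _)

theorem closure_univ : r.closure Set.univ = Set.univ :=
  Set.univ_subset_iff.1 (r.subset_closure _)

theorem closure_mul_univ (X : Set H) : r.closure (X * Set.univ) = r.closure X := by
  apply subset_antisymm
  · exact r.closure_subset _ _ (Set.subset_union_left.trans (r.mul_union_zero_subset X))
  · exact r.closure_mono fun x hx => ⟨x, hx, 1, Set.mem_univ _, mul_one x⟩

theorem closure_mul_closure_right (X Y : Set H) :
    r.closure (X * r.closure Y) = r.closure (X * Y) := by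
  apply subset_antisymm
  · apply r.closure_subset
    rintro _ ⟨x, hx, y, hy, rfl⟩
    have h : x * y ∈ r.closure (x • Y) := r.smul_closure_subset x Y ⟨y, hy, rfl⟩
    refine r.closure_mono ?_ h
    rintro _ ⟨z, hz, rfl⟩
    exact ⟨x, hx, z, hz, rfl⟩
  · exact r.closure_mono (Set.mul_subset_mul_left (r.subset_closure Y))

/-! ## The multiplicative lattice of `r`-ideals -/

/-- The set `I_r(H)` of all `r`-ideals of `H`. -/
def RIdeal : Type u := {I : Set H // r.IsRIdeal I}

variable {r}

/-- The underlying subset of an `r`-ideal. -/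
def RIdeal.carrier (I : r.RIdeal) : Set H := I.1

variable (r)

/-- The `r`-ideal `X_r`. -/
def span (X : Set H) : r.RIdeal := ⟨r.closure X, r.closure_closure X⟩

/-- `r`-ideals are ordered by inclusion. -/
instance : PartialOrder r.RIdeal :=
  PartialOrder.lift RIdeal.carrier fun _ _ h => Subtype.ext h

/-- The map `X ↦ X_r` is left adjoint to the inclusion of the `r`-ideals in the subsets. -/
def spanGI : GaloisInsertion r.span (RIdeal.carrier (r := r)) where
  choice X _ := r.span X
  gc X I := by
    constructor
    · exact fun h => (r.subset_closure X).trans h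
    · intro h
      have h2 := r.closure_mono h
      rwa [show r.closure I.carrier = I.carrier from I.2] at h2
  le_l_u I := r.subset_closure I.carrier
  choice_eq _ _ := rfl

/-- `I_r(H)` is a complete lattice: the join of a family of `r`-ideals is the `r`-closure of its
union, the meet is the intersection. -/
instance : CompleteLattice r.RIdeal := r.spanGI.liftCompleteLattice

/-- The `r`-multiplication `(I, J) ↦ (I J)_r`, with the identity element `H`. -/
instance : CommMonoid r.RIdeal where
  mul I J := r.span (I.carrier * J.carrier)
  one := ⟨Set.univ, r.closure_univ⟩
  mul_assoc I J K := by
    apply Subtype.ext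
    change r.closure (r.closure (I.carrier * J.carrier) * K.carrier)
      = r.closure (I.carrier * r.closure (J.carrier * K.carrier))
    rw [mul_comm (r.closure _), closure_mul_closure_right, closure_mul_closure_right,
      mul_comm K.carrier, mul_assoc]
  mul_comm I J := by
    apply Subtype.ext
    change r.closure (I.carrier * J.carrier) = r.closure (J.carrier * I.carrier)
    rw [mul_comm]
  one_mul I := by
    apply Subtype.ext
    change r.closure (Set.univ * I.carrier) = I.carrier
    rw [mul_comm, closure_mul_univ]
    exact I.2
  mul_one I := by
    apply Subtype.ext
    change r.closure (I.carrier * Set.univ) = I.carrier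
    rw [closure_mul_univ]
    exact I.2

/-! ## Properties of `r`-ideals -/

/-- `x` is a regular element: it is cancellative and `(x A)_r = x A_r` for all `A`. -/
def IsRegularElement (x : H) : Prop :=
  IsCancellativeElement x ∧ ∀ A : Set H, r.closure (x • A) = x • r.closure A

/-- `I` is regular: it contains a regular element. -/
def IsRegularSet (I : Set H) : Prop := ∃ x ∈ I, r.IsRegularElement x

/-- `I` is `r`-invertible: `(I J)_r = y H` for some subset `J` and some regular element `y`. -/
def IsInvertible (I : Set H) : Prop :=
  ∃ (J : Set H) (y : H), r.IsRegularElement y ∧ r.closure (I * J) = y • (Set.univ : Set H)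

/-- `I` is an `r`-finitely generated `r`-ideal: `I = E_r` for some finite subset `E` of `I`. -/
def IsFinitelyGenerated (I : Set H) : Prop :=
  ∃ E : Set H, E.Finite ∧ E ⊆ I ∧ I = r.closure E

variable {r}

namespace RIdeal

/-- `I` is nontrivial: it properly contains `z(H)`. -/
def IsNontrivial (I : r.RIdeal) : Prop := zeroElements H ⊂ I.carrier

/-- `I` is proper: it is not all of `H`. -/
def IsProper (I : r.RIdeal) : Prop := I.carrier ⊂ Set.univ

/-- `I` is radical: `x ^ n ∈ I` with `n ≥ 1` implies `x ∈ I`. -/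
def IsRadical (I : r.RIdeal) : Prop :=
  ∀ (n : ℕ) (x : H), 1 ≤ n → x ^ n ∈ I.carrier → x ∈ I.carrier

/-- `I` is prime: it is proper, and `x y ∈ I` implies `x ∈ I` or `y ∈ I`. -/
def IsPrime (I : r.RIdeal) : Prop :=
  I.IsProper ∧ ∀ x y : H, x * y ∈ I.carrier → x ∈ I.carrier ∨ y ∈ I.carrier

/-- The radical of `I`: all elements that have a power `x ^ n`, `n ≥ 1`, in `I`. -/
def radical (I : r.RIdeal) : Set H := {x | ∃ n : ℕ, 1 ≤ n ∧ x ^ n ∈ I.carrier}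

/-- `p` is an `ℓ`-prime element of the multiplicative lattice of `r`-ideals. -/
def IsLPrime (p : r.RIdeal) : Prop :=
  p ≠ 1 ∧ ∀ a b : r.RIdeal, a * b ≤ p → a ≤ p ∨ b ≤ p

end RIdeal

variable (r)

/-- `dim_r(H)`, the dimension of the multiplicative lattice of `r`-ideals: the supremum of the
`n` such that there is a chain `p_0 < ⋯ < p_n` of `ℓ`-prime elements. -/
noncomputable def dim : WithBot ℕ∞ := Order.krullDim {p : r.RIdeal // p.IsLPrime}

/-- `H` is an `r`-SP-monoid: every `r`-ideal is a finite `r`-product of radical `r`-ideals. -/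
def IsSPMonoid : Prop :=
  ∀ I : r.RIdeal, ∃ l : List r.RIdeal, (∀ J ∈ l, J.IsRadical) ∧ I = l.prod

/-- `H` is an `r`-Prüfer monoid: every regular `r`-finitely generated `r`-ideal is
`r`-invertible. -/
def IsPruferMonoid : Prop :=
  ∀ I : r.RIdeal, r.IsRegularSet I.carrier → r.IsFinitelyGenerated I.carrier →
    r.IsInvertible I.carrier

/-- The set `r-max(H)` of nontrivial `r`-maximal `r`-ideals. If `H` is cancellative, `r` is an
ideal system and some nonzero element of `H` is not a unit, then every maximal proper `r`-ideal is
nontrivial, so that this is the set of all `r`-maximal `r`-ideals. -/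
def MaxSpectrum : Type u :=
  {m : r.RIdeal // m.IsNontrivial ∧ m.IsProper ∧ ∀ I : r.RIdeal, I.IsProper → m ≤ I → I = m}

/-- The inverse topology on `r-max(H)`: the sets `{m | x ≤ m}` with `x` a compact element of the
lattice of `r`-ideals form a basis of open sets. -/
instance : TopologicalSpace r.MaxSpectrum :=
  TopologicalSpace.generateFrom
    {V | ∃ x : r.RIdeal, IsCompactElement x ∧ V = {m : r.MaxSpectrum | x ≤ m.1}}

end WeakIdealSystem

/-! ## Upper semicontinuous functions -/

/-- The set `U(X)` of compactly supported upper semicontinuous functions from `X` to the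
nonnegative integers. -/
def USCFun (X : Type u) [TopologicalSpace X] : Type u :=
  {f : X → ℕ // UpperSemicontinuous f ∧ HasCompactSupport f}

namespace USCFun

variable {X : Type u} [TopologicalSpace X]

/-- The order `f ≤ g` iff `f x ≥ g x` for all `x`, dual to the usual one. -/
instance : PartialOrder (USCFun X) where
  le f g := ∀ x, g.1 x ≤ f.1 x
  le_refl f x := le_refl (f.1 x)
  le_trans _ _ _ h₁ h₂ x := (h₂ x).trans (h₁ x)
  le_antisymm _ _ h₁ h₂ := Subtype.ext (funext fun x => le_antisymm (h₂ x) (h₁ x))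

/-- The operation of the monoid `U(X)`, here written as a multiplication, is the pointwise
addition of functions; its identity element is the zero function. -/
instance : CommMonoid (USCFun X) where
  mul f g := ⟨fun x => f.1 x + g.1 x, f.2.1.add g.2.1, f.2.2.add g.2.2⟩
  one := ⟨fun _ => 0, upperSemicontinuous_const, HasCompactSupport.zero⟩
  mul_assoc f g h := Subtype.ext (funext fun x => add_assoc (f.1 x) (g.1 x) (h.1 x))
  mul_comm f g := Subtype.ext (funext fun x => add_comm (f.1 x) (g.1 x))
  one_mul f := Subtype.ext (funext fun x => zero_add (f.1 x))
  mul_one f := Subtype.ext (funext fun x => add_zero (f.1 x))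

end USCFun

/-- The ordered monoid `U_b(X)`: `U(X)` with an absorbing bottom element `b` (the `0` of
`WithZero`) appended. -/
abbrev UBot (X : Type u) [TopologicalSpace X] : Type u := WithZero (USCFun X)

/-! All conditions are compared through two properties: every localization at a nontrivial maximal
`r`-ideal `M` is a discrete valuation monoid (`IsAlmostDedekind`), and every such `M` contains a
nontrivial compact radical `r`-ideal `J` (`HasCompactRadicals`). The first makes a nontrivial `I`
determined by its values `val M I`, with products becoming sums and inclusion the reversed order.
The second supplies powers `J ^ n` with value `n` at `M` and at most `n` elsewhere. Hence value
functions are upper semicontinuous (`upperSemicontinuous_val`) and all functions in `U` occur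
(`ofFun_ne_bot_and_val_ofFun`), which is the isomorphism. Splitting a function into the indicators
of its level sets gives the unique ascending radical factorization; subtracting the indicator of a
clopen zero locus shows that radicals of compact `r`-ideals are invertible.

It remains to derive both properties. An invertible `J` is compact and locally generated by one `p`;
one needs that `p` generates `M` locally and that no nonzero element is divisible by all powers of
`p`. In dimension one this holds because `M` is the only nontrivial prime below `M`. If radicals are
invertible, the radical of `(u) ⊔ (v)` yields a local common divisor, and a squarefree argument
applies (`mem_loc_princ_of_mem_loc_princ`). For SP-monoids the hard step is
`IsSPMonoid.mem_loc_princ`: if `w ∈ M` were not locally divisible by `y`, factoring `(w ^ 2) ⊔ C`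
with `C` the local residual of `(y)` by `w` would force `C` to be locally equal to `C * ((w) ⊔ C)`,
which is absurd. Modularity replaces subtraction there, allowing cancellation modulo `C`. -/

namespace WeakIdealSystem

/-- A finitary ideal system `r` on a cancellative monoid such that `∅_r` is not the whole
monoid. -/
class IsCancellativeSystem {H : Type u} [CommMonoid H] (r : WeakIdealSystem H) : Prop where
  nontrivial : Nontrivial H
  cancellative : IsCancellativeMonoid H
  isIdealSystem : r.IsIdealSystem
  isFinitary : r.IsFinitary
  closure_empty_ne : r.closure ∅ ≠ Set.univ

variable {H : Type u} [CommMonoid H] {r : WeakIdealSystem H}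

/-! ### Arithmetic in the lattice of `r`-ideals -/

instance : Membership H r.RIdeal := ⟨fun I x => x ∈ I.carrier⟩

theorem mem_carrier {I : r.RIdeal} {x : H} : x ∈ I.carrier ↔ x ∈ I := Iff.rfl

theorem le_iff {I J : r.RIdeal} : I ≤ J ↔ ∀ x ∈ I, x ∈ J := Iff.rfl

theorem span_le {X : Set H} {I : r.RIdeal} : r.span X ≤ I ↔ ∀ x ∈ X, x ∈ I :=
  r.spanGI.gc X I

theorem mem_span {X : Set H} {x : H} : x ∈ r.span X ↔ x ∈ r.closure X := Iff.rfl

theorem subset_span {X : Set H} {x : H} (h : x ∈ X) : x ∈ r.span X := r.subset_closure X h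

theorem closure_carrier (I : r.RIdeal) : r.closure I.carrier = I.carrier := I.2

theorem span_carrier (I : r.RIdeal) : r.span I.carrier = I := Subtype.ext I.2

theorem mul_mem_right {I : r.RIdeal} {x : H} (hx : x ∈ I) (y : H) : x * y ∈ I := by
  have := r.mul_union_zero_subset I.carrier (Or.inl ⟨x, hx, y, Set.mem_univ _, rfl⟩)
  rwa [closure_carrier] at this

theorem mul_mem_left {I : r.RIdeal} {x : H} (y : H) (hx : x ∈ I) : y * x ∈ I :=
  mul_comm x y ▸ mul_mem_right hx y

theorem mul_mem_mul {I J : r.RIdeal} {x y : H} (hx : x ∈ I) (hy : y ∈ J) : x * y ∈ I * J :=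
  r.subset_closure _ ⟨x, hx, y, hy, rfl⟩

theorem mul_le {I J K : r.RIdeal} : I * J ≤ K ↔ ∀ x ∈ I, ∀ y ∈ J, x * y ∈ K := by
  refine ⟨fun h x hx y hy => h (mul_mem_mul hx hy), fun h => span_le.2 ?_⟩
  rintro _ ⟨x, hx, y, hy, rfl⟩
  exact h x hx y hy

theorem mem_one (x : H) : x ∈ (1 : r.RIdeal) := Set.mem_univ x

theorem le_one (I : r.RIdeal) : I ≤ 1 := fun x _ => mem_one x

theorem one_eq_top : (1 : r.RIdeal) = ⊤ := top_le_iff.1 (le_one ⊤)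

theorem eq_one_iff {I : r.RIdeal} : I = 1 ↔ (1 : H) ∈ I := by
  refine ⟨fun h => h ▸ mem_one 1, fun h => (le_one I).antisymm fun x _ => ?_⟩
  exact one_mul x ▸ mul_mem_right h x

instance : IsOrderedMonoid r.RIdeal where
  mul_le_mul_left _ _ h _ := mul_le.2 fun _ hx _ hy => mul_mem_mul (h hx) hy

theorem mul_le_left (I J : r.RIdeal) : I * J ≤ I := mul_le.2 fun _ hx y _ => mul_mem_right hx y

theorem mul_le_right (I J : r.RIdeal) : I * J ≤ J := mul_comm J I ▸ mul_le_left J I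

/-- The residual `(c : S)` of an `r`-ideal by a set. -/
def colon (c : r.RIdeal) (S : Set H) : r.RIdeal :=
  ⟨{x | ∀ y ∈ S, x * y ∈ c}, by
    refine subset_antisymm (fun x hx y hy => ?_) (r.subset_closure _)
    have h := r.smul_closure_subset y _ ⟨x, hx, rfl⟩
    have h2 : y • {x | ∀ y ∈ S, x * y ∈ c} ⊆ r.closure c.carrier := by
      rintro _ ⟨z, hz, rfl⟩
      rw [closure_carrier]
      exact (mul_comm z y ▸ hz y hy : y * z ∈ c)
    have h3 := r.closure_subset _ _ h2 h
    rw [closure_carrier] at h3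
    exact mul_comm y x ▸ h3⟩

theorem mem_colon {c : r.RIdeal} {S : Set H} {x : H} : x ∈ colon c S ↔ ∀ y ∈ S, x * y ∈ c :=
  Iff.rfl

theorem mem_colon_singleton {c : r.RIdeal} {x y : H} : x ∈ colon c {y} ↔ x * y ∈ c := by
  simp [mem_colon]

theorem le_colon {I J c : r.RIdeal} : I ≤ colon c J.carrier ↔ I * J ≤ c := mul_le.symm

theorem le_colon_self (c : r.RIdeal) (S : Set H) : c ≤ colon c S :=
  fun _ hx y _ => mul_mem_right hx y

theorem mul_sup (I J K : r.RIdeal) : I * (J ⊔ K) = I * J ⊔ I * K := by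
  apply le_antisymm
  · rw [mul_comm, ← le_colon]
    refine sup_le ?_ ?_ <;> rw [le_colon, mul_comm]
    exacts [le_sup_left, le_sup_right]
  · exact sup_le (mul_le_mul_right le_sup_left I) (mul_le_mul_right le_sup_right I)

theorem sup_mul (I J K : r.RIdeal) : (I ⊔ J) * K = I * K ⊔ J * K := by
  rw [mul_comm, mul_sup, mul_comm K, mul_comm K]

theorem mem_inf {I J : r.RIdeal} {x : H} : x ∈ I ⊓ J ↔ x ∈ I ∧ x ∈ J := by
  have : (I ⊓ J).carrier = I.carrier ∩ J.carrier := r.spanGI.gc.u_inf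
  rw [← mem_carrier, this]; rfl

theorem mem_iInf {ι : Sort*} {f : ι → r.RIdeal} {x : H} : x ∈ ⨅ i, f i ↔ ∀ i, x ∈ f i := by
  have : (⨅ i, f i).carrier = ⨅ i, (f i).carrier := r.spanGI.gc.u_iInf
  rw [← mem_carrier, this]; simp; rfl

theorem sup_eq_span (I J : r.RIdeal) : I ⊔ J = r.span (I.carrier ∪ J.carrier) := by
  apply le_antisymm
  · exact sup_le (fun x hx => subset_span (Or.inl hx)) (fun x hx => subset_span (Or.inr hx))
  · refine span_le.2 ?_
    rintro x (hx | hx)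
    exacts [(le_sup_left : I ≤ I ⊔ J) hx, (le_sup_right : J ≤ I ⊔ J) hx]

theorem isModularLattice_of_isModular (h : r.IsModular) : IsModularLattice r.RIdeal where
  sup_inf_le_assoc_of_le {I} J {N} hIN := by
    intro x hx
    have hx := mem_inf.1 hx
    rw [sup_eq_span] at hx ⊢
    have := h I.carrier J.carrier N.carrier I.2 J.2 N.2 hIN ⟨hx.1, hx.2⟩
    have e : (J ⊓ N).carrier = J.carrier ∩ N.carrier := r.spanGI.gc.u_inf
    rw [e]
    exact this

/-- The principal `r`-ideal generated by `x`. -/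
def princ (r : WeakIdealSystem H) (x : H) : r.RIdeal := r.span {x}

theorem princ_le {I : r.RIdeal} {x : H} : r.princ x ≤ I ↔ x ∈ I := by
  simp [princ, span_le]

theorem mem_princ_self (x : H) : x ∈ r.princ x := princ_le.1 le_rfl

theorem princ_one : r.princ 1 = 1 := eq_one_iff.2 (mem_princ_self 1)

theorem span_mul_span (X Y : Set H) : r.span X * r.span Y = r.span (X * Y) := by
  apply Subtype.ext
  change r.closure (r.closure X * r.closure Y) = r.closure (X * Y)
  rw [closure_mul_closure_right, mul_comm, closure_mul_closure_right, mul_comm]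

theorem princ_mul (x y : H) : r.princ (x * y) = r.princ x * r.princ y := by
  rw [princ, princ, princ, span_mul_span, Set.singleton_mul_singleton]

theorem princ_pow (x : H) (n : ℕ) : r.princ (x ^ n) = r.princ x ^ n := by
  induction n with
  | zero => simp [princ_one]
  | succ n ih => rw [pow_succ, pow_succ, princ_mul, ih]

theorem pow_mem_pow {I : r.RIdeal} {x : H} (hx : x ∈ I) (n : ℕ) : x ^ n ∈ I ^ n := by
  rw [← princ_le, princ_pow]
  exact pow_le_pow_left' (princ_le.2 hx) n

theorem prod_le_of_mem {l : List r.RIdeal} {I : r.RIdeal} (h : I ∈ l) : l.prod ≤ I := by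
  induction l with
  | nil => simp at h
  | cons J l ih =>
    rw [List.prod_cons]
    rcases List.mem_cons.1 h with rfl | h
    exacts [mul_le_left _ _, (mul_le_right _ _).trans (ih h)]

theorem exists_mul_eq_prod {l : List r.RIdeal} {I : r.RIdeal} (h : I ∈ l) :
    ∃ J, I * J = l.prod := by
  classical
  exact ⟨_, List.prod_erase h⟩

theorem pow_length_le_prod {l : List r.RIdeal} {I : r.RIdeal} (h : ∀ J ∈ l, I ≤ J) :
    I ^ l.length ≤ l.prod := by
  induction l with
  | nil => simp
  | cons J l ih =>
    rw [List.prod_cons, List.length_cons, pow_succ']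
    exact mul_le_mul' (h J (by simp)) (ih fun K hK => h K (by simp [hK]))

/-! ### Primes and radicals -/

theorem isProper_iff {I : r.RIdeal} : I.IsProper ↔ I ≠ 1 := by
  rw [RIdeal.IsProper, Set.ssubset_univ_iff, not_iff_not]
  exact ⟨fun h => Subtype.ext h, fun h => h ▸ rfl⟩

theorem RIdeal.IsPrime.ne_one {P : r.RIdeal} (h : P.IsPrime) : P ≠ 1 := isProper_iff.1 h.1

theorem RIdeal.IsPrime.one_notMem {P : r.RIdeal} (h : P.IsPrime) : (1 : H) ∉ P :=
  fun h1 => h.ne_one (eq_one_iff.2 h1)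

theorem RIdeal.IsPrime.mem_or_mem {P : r.RIdeal} (h : P.IsPrime) {x y : H} (hxy : x * y ∈ P) :
    x ∈ P ∨ y ∈ P := h.2 x y hxy

theorem RIdeal.IsPrime.mul_notMem {P : r.RIdeal} (h : P.IsPrime) {x y : H} (hx : x ∉ P)
    (hy : y ∉ P) : x * y ∉ P := fun hxy => (h.mem_or_mem hxy).elim hx hy

theorem RIdeal.IsPrime.pow_notMem {P : r.RIdeal} (h : P.IsPrime) {x : H} (hx : x ∉ P) (n : ℕ) :
    x ^ n ∉ P := by
  induction n with
  | zero => simpa using h.one_notMem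
  | succ n ih => rw [pow_succ]; exact h.mul_notMem ih hx

theorem isLPrime_iff_isPrime {P : r.RIdeal} : P.IsLPrime ↔ P.IsPrime := by
  rw [RIdeal.IsLPrime, RIdeal.IsPrime, isProper_iff]
  refine and_congr_right fun _ => ⟨fun h x y hxy => ?_, fun h I J hIJ => ?_⟩
  · have := h (r.princ x) (r.princ y)
    rw [← princ_mul, princ_le, princ_le, princ_le] at this
    exact this hxy
  · by_contra! hc
    obtain ⟨x, hx, hxP⟩ := Set.not_subset.1 hc.1
    obtain ⟨y, hy, hyP⟩ := Set.not_subset.1 hc.2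
    exact (h x y (hIJ (mul_mem_mul hx hy))).elim hxP hyP

theorem RIdeal.IsPrime.le_or_le {P I J : r.RIdeal} (h : P.IsPrime) (hIJ : I * J ≤ P) :
    I ≤ P ∨ J ≤ P := (isLPrime_iff_isPrime.2 h).2 I J hIJ

theorem RIdeal.IsPrime.exists_le_of_prod_le {P : r.RIdeal} (h : P.IsPrime) {l : List r.RIdeal}
    (hl : l.prod ≤ P) : ∃ I ∈ l, I ≤ P := by
  induction l with
  | nil => exact absurd ((le_one P).antisymm hl) h.ne_one
  | cons J l ih =>
    rw [List.prod_cons] at hl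
    rcases h.le_or_le hl with h1 | h1
    · exact ⟨J, by simp, h1⟩
    · obtain ⟨I, hI, hIP⟩ := ih h1
      exact ⟨I, by simp [hI], hIP⟩

theorem RIdeal.IsPrime.le_of_pow_le {P I : r.RIdeal} (h : P.IsPrime) {n : ℕ} (hI : I ^ n ≤ P) :
    I ≤ P := by
  induction n with
  | zero => exact absurd ((le_one P).antisymm (by simpa using hI)) h.ne_one
  | succ n ih => rw [pow_succ] at hI; exact (h.le_or_le hI).elim ih id

theorem RIdeal.IsPrime.isRadical {P : r.RIdeal} (h : P.IsPrime) : P.IsRadical :=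
  fun n _ _ hx => by_contra fun hxP => h.pow_notMem hxP n hx

theorem RIdeal.IsRadical.mem_of_pow_mem {I : r.RIdeal} (h : I.IsRadical) {x : H} {n : ℕ}
    (hx : x ^ n ∈ I) : x ∈ I := by
  rcases Nat.eq_zero_or_pos n with rfl | hn
  · rw [pow_zero] at hx
    simpa using mul_mem_right hx x
  · exact h n x hn hx

theorem RIdeal.IsRadical.le_of_pow_le {I J : r.RIdeal} (h : I.IsRadical) {n : ℕ}
    (hJ : J ^ n ≤ I) : J ≤ I :=
  fun _ hx => h.mem_of_pow_mem (hJ (pow_mem_pow hx n))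

/-- This form of radicality uses only order and multiplication, so it can be tested through an
isomorphism of multiplicative lattices. -/
theorem isRadical_iff_forall_pow_le {I : r.RIdeal} :
    I.IsRadical ↔ ∀ (J : r.RIdeal) (n : ℕ), J ^ n ≤ I → J ≤ I := by
  refine ⟨fun h J n => h.le_of_pow_le, fun h n x _ hx => ?_⟩
  have := h (r.princ x) n
  rw [← princ_pow, princ_le, princ_le] at this
  exact this hx

/-! ### Consequences of cancellation -/

section Cancellative

variable [hr : r.IsCancellativeSystem]

theorem mem_princ {x y : H} : y ∈ r.princ x ↔ ∃ h, y = x * h := by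
  constructor
  · intro hy
    have h := hr.isIdealSystem x {1}
    have h1 : r.closure {1} = Set.univ := congrArg RIdeal.carrier (princ_one (r := r))
    have hy' : y ∈ r.closure (x • {1}) := by
      rw [Set.smul_set_singleton, smul_eq_mul, mul_one]
      exact hy
    rw [← h, h1] at hy'
    obtain ⟨z, -, hz⟩ := hy'
    exact ⟨z, hz.symm⟩
  · rintro ⟨h, rfl⟩
    exact mul_mem_right (mem_princ_self x) h

theorem mem_princ_mul {x y : H} {I : r.RIdeal} :
    y ∈ r.princ x * I ↔ ∃ i ∈ I, y = x * i := by
  constructor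
  · intro hy
    rw [← span_carrier I, princ, span_mul_span, Set.singleton_mul, mem_span] at hy
    have h := hr.isIdealSystem x I.carrier
    rw [closure_carrier] at h
    have hy' : y ∈ x • I.carrier := by rw [h]; exact hy
    obtain ⟨i, hi, rfl⟩ := hy'
    exact ⟨i, hi, rfl⟩
  · rintro ⟨i, hi, rfl⟩
    exact mul_mem_mul (mem_princ_self x) hi

theorem mul_left_cancel_of_nonzero (r : WeakIdealSystem H) [hr : r.IsCancellativeSystem]
    {x y z : H} (hx : x ∉ zeroElements H) (h : x * y = x * z) :
    y = z := hr.cancellative x hx y z h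

theorem mul_mem_princ_mul {x y : H} (hx : x ∉ zeroElements H) {I : r.RIdeal} :
    x * y ∈ r.princ x * I ↔ y ∈ I := by
  refine ⟨fun h => ?_, mul_mem_mul (mem_princ_self x)⟩
  obtain ⟨i, hi, h⟩ := mem_princ_mul.1 h
  exact mul_left_cancel_of_nonzero r hx h ▸ hi

/-- If a nonzero `x` lies in `∅_r`, then `x ∅_r = ∅_r` contains `x`, and cancelling `x` puts `1`
into `∅_r`. -/
theorem closure_empty : r.closure ∅ = zeroElements H := by
  refine subset_antisymm (fun x hx => by_contra fun hxz => hr.closure_empty_ne ?_)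
    (Set.subset_union_right.trans (r.mul_union_zero_subset ∅))
  have h := hr.isIdealSystem x ∅
  rw [Set.smul_set_empty] at h
  have hx' := hx
  rw [← h] at hx'
  obtain ⟨y, hy, hxy⟩ := hx'
  have : y = 1 := mul_left_cancel_of_nonzero r hxz (hxy.trans (mul_one x).symm)
  subst this
  exact congrArg RIdeal.carrier (eq_one_iff (I := r.span ∅).2 hy)

theorem mem_bot {x : H} : x ∈ (⊥ : r.RIdeal) ↔ x ∈ zeroElements H := by
  rw [← closure_empty (r := r), ← mem_span]
  have : r.span ∅ = ⊥ := r.spanGI.gc.l_bot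
  rw [this]

theorem carrier_bot : (⊥ : r.RIdeal).carrier = zeroElements H := Set.ext fun _ => mem_bot

theorem ne_bot_iff {I : r.RIdeal} : I ≠ ⊥ ↔ ∃ x ∈ I, x ∉ zeroElements H := by
  rw [ne_eq, ← le_bot_iff, le_iff, not_forall]
  simp only [mem_bot, Classical.not_imp]

theorem isNontrivial_iff {I : r.RIdeal} : I.IsNontrivial ↔ I ≠ ⊥ := by
  rw [RIdeal.IsNontrivial, ← carrier_bot (r := r)]
  exact bot_lt_iff_ne_bot (a := I)

theorem ne_bot_of_mem {I : r.RIdeal} {x : H} (hx : x ∈ I) (h : x ∉ zeroElements H) : I ≠ ⊥ :=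
  ne_bot_iff.2 ⟨x, hx, h⟩

theorem princ_ne_bot {x : H} (h : x ∉ zeroElements H) : r.princ x ≠ ⊥ :=
  ne_bot_of_mem (mem_princ_self x) h

end Cancellative

end WeakIdealSystem

namespace WeakIdealSystem

variable {H : Type u} [CommMonoid H] {r : WeakIdealSystem H} [hr : r.IsCancellativeSystem]

/-! ### Zero elements -/

theorem mem_of_mem_zeroElements {I : r.RIdeal} {x : H} (hx : x ∈ zeroElements H) : x ∈ I :=
  (bot_le : ⊥ ≤ I) (mem_bot.2 hx)

theorem mem_zeroElements_or (r : WeakIdealSystem H) [hr : r.IsCancellativeSystem] {x y : H}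
    (h : x * y ∈ zeroElements H) : x ∈ zeroElements H ∨ y ∈ zeroElements H := by
  by_cases hx : x ∈ zeroElements H
  · exact Or.inl hx
  · have : y = x * y := mul_left_cancel_of_nonzero r hx (h x).symm
    exact Or.inr (this ▸ h)

theorem one_notMem_zeroElements (r : WeakIdealSystem H) [hr : r.IsCancellativeSystem] :
    (1 : H) ∉ zeroElements H := fun h => by
  obtain ⟨x, y, hxy⟩ := hr.nontrivial
  have hx := h x
  have hy := h y
  rw [mul_one] at hx hy
  exact hxy (hx.trans hy.symm)

theorem isPrime_bot : (⊥ : r.RIdeal).IsPrime := by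
  refine ⟨isProper_iff.2 fun h => ?_, fun x y h => ?_⟩
  · exact one_notMem_zeroElements r (mem_bot.1 (eq_one_iff.1 h))
  · simp only [mem_carrier, mem_bot] at h ⊢
    exact mem_zeroElements_or r h

theorem one_ne_bot : (1 : r.RIdeal) ≠ ⊥ := isPrime_bot.ne_one.symm

theorem mul_ne_bot {I J : r.RIdeal} (hI : I ≠ ⊥) (hJ : J ≠ ⊥) : I * J ≠ ⊥ := fun h =>
  (isPrime_bot.le_or_le h.le).elim (fun h => hI (le_bot_iff.1 h)) fun h => hJ (le_bot_iff.1 h)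

theorem pow_ne_bot {I : r.RIdeal} (hI : I ≠ ⊥) (n : ℕ) : I ^ n ≠ ⊥ := fun h =>
  hI (le_bot_iff.1 (isPrime_bot.le_of_pow_le h.le))

omit hr in
theorem bot_mul' (I : r.RIdeal) : ⊥ * I = ⊥ := le_bot_iff.1 (mul_le_left _ _)

theorem nonzero_of_notMem {I : r.RIdeal} {x : H} (h : x ∉ I) : x ∉ zeroElements H :=
  fun hx => h (mem_of_mem_zeroElements hx)

theorem pow_nonzero (r : WeakIdealSystem H) [hr : r.IsCancellativeSystem] {x : H}
    (hx : x ∉ zeroElements H) (n : ℕ) : x ^ n ∉ zeroElements H := by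
  rw [← mem_bot (r := r)] at hx ⊢
  exact isPrime_bot.pow_notMem hx n

theorem isRegularElement_iff {x : H} : r.IsRegularElement x ↔ x ∉ zeroElements H := by
  refine ⟨fun h hx => ?_, fun h => ⟨hr.cancellative x h, fun A => (hr.isIdealSystem x A).symm⟩⟩
  obtain ⟨y, z, hyz⟩ := hr.nontrivial
  exact hyz (h.1 y z (by rw [mul_comm, hx y, mul_comm, hx z]))

theorem princ_mul_cancel {x : H} (hx : x ∉ zeroElements H) {I J : r.RIdeal}
    (h : r.princ x * I ≤ r.princ x * J) : I ≤ J := fun _ hy =>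
  (mul_mem_princ_mul hx).1 (h ((mul_mem_princ_mul hx).2 hy))

/-! ### Compact elements -/

theorem exists_finite_of_mem_span {X : Set H} {x : H} (hx : x ∈ r.span X) :
    ∃ E ⊆ X, E.Finite ∧ x ∈ r.span E := by
  rw [mem_span, hr.isFinitary X] at hx
  simp only [Set.mem_iUnion, Set.mem_ofPred_eq, exists_prop] at hx
  obtain ⟨E, ⟨h1, h2⟩, h3⟩ := hx
  exact ⟨E, h1, h2, h3⟩

omit hr in
theorem exists_forall_mem_of_finite {s : Set r.RIdeal} (hne : s.Nonempty)
    (hd : DirectedOn (· ≤ ·) s) {E : Set H} (hE : E.Finite) (h : ∀ x ∈ E, ∃ I ∈ s, x ∈ I) :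
    ∃ I ∈ s, ∀ x ∈ E, x ∈ I := by
  induction E, hE using Set.Finite.induction_on with
  | empty => obtain ⟨I, hI⟩ := hne; exact ⟨I, hI, by simp⟩
  | @insert a E _ _ ih =>
    obtain ⟨I, hI, hIE⟩ := ih fun x hx => h x (Set.mem_insert_of_mem _ hx)
    obtain ⟨J, hJ, haJ⟩ := h a (Set.mem_insert _ _)
    obtain ⟨K, hK, hIK, hJK⟩ := hd I hI J hJ
    refine ⟨K, hK, fun x hx => ?_⟩
    rcases Set.mem_insert_iff.1 hx with rfl | hx
    exacts [hJK haJ, hIK (hIE x hx)]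

theorem exists_mem_of_isLUB {s : Set r.RIdeal} (hne : s.Nonempty) (hd : DirectedOn (· ≤ ·) s)
    {u : r.RIdeal} (hu : IsLUB s u) {E : Set H} (hE : E.Finite) (h : ∀ x ∈ E, x ∈ u) :
    ∃ I ∈ s, ∀ x ∈ E, x ∈ I := by
  refine exists_forall_mem_of_finite hne hd hE fun x hx => ?_
  have hle : u ≤ r.span (⋃ I ∈ s, I.carrier) :=
    hu.2 fun I hI y hy => subset_span (Set.mem_biUnion hI hy)
  obtain ⟨F, hF, hFfin, hxF⟩ := exists_finite_of_mem_span (hle (h x hx))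
  obtain ⟨I, hI, hFI⟩ := exists_forall_mem_of_finite hne hd hFfin fun y hy => by
    simpa [mem_carrier] using hF hy
  exact ⟨I, hI, span_le.2 hFI hxF⟩

theorem isCompactElement_span {E : Set H} (hE : E.Finite) : IsCompactElement (r.span E) := by
  intro s u hne hd hu h
  obtain ⟨I, hI, h⟩ := exists_mem_of_isLUB hne hd hu hE (span_le.1 h)
  exact ⟨I, hI, span_le.2 h⟩

omit hr in
theorem exists_span_of_isCompactElement {I : r.RIdeal} (h : IsCompactElement I) :
    ∃ E : Set H, E.Finite ∧ I = r.span E := by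
  let s : Set r.RIdeal := {J | ∃ E : Set H, E.Finite ∧ E ⊆ I.carrier ∧ J = r.span E}
  have hne : s.Nonempty := ⟨_, ∅, Set.finite_empty, Set.empty_subset _, rfl⟩
  have hd : DirectedOn (· ≤ ·) s := by
    rintro _ ⟨E, hE, hEI, rfl⟩ _ ⟨F, hF, hFI, rfl⟩
    exact ⟨_, ⟨E ∪ F, hE.union hF, Set.union_subset hEI hFI, rfl⟩,
      span_le.2 fun x hx => subset_span (Or.inl hx), span_le.2 fun x hx => subset_span (Or.inr hx)⟩
  have hlub : IsLUB s I := by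
    refine ⟨?_, fun J hJ x hx => ?_⟩
    · rintro _ ⟨E, hE, hEI, rfl⟩
      exact span_le.2 hEI
    · exact hJ ⟨{x}, Set.finite_singleton x, Set.singleton_subset_iff.2 hx, rfl⟩
        (mem_princ_self x)
  obtain ⟨_, ⟨E, hE, hEI, rfl⟩, hIE⟩ := h s I hne hd hlub le_rfl
  exact ⟨E, hE, hIE.antisymm (span_le.2 hEI)⟩

theorem isCompactElement_iff {I : r.RIdeal} :
    IsCompactElement I ↔ ∃ E : Set H, E.Finite ∧ I = r.span E :=
  ⟨exists_span_of_isCompactElement, fun ⟨_, hE, h⟩ => h ▸ isCompactElement_span hE⟩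

theorem isFinitelyGenerated_iff {I : r.RIdeal} :
    r.IsFinitelyGenerated I.carrier ↔ IsCompactElement I := by
  rw [isCompactElement_iff]
  constructor
  · rintro ⟨E, hE, -, h⟩
    exact ⟨E, hE, Subtype.ext h⟩
  · rintro ⟨E, hE, rfl⟩
    exact ⟨E, hE, r.subset_closure E, rfl⟩

theorem isCompactElement_princ (x : H) : IsCompactElement (r.princ x) :=
  isCompactElement_span (Set.finite_singleton x)

theorem isCompactElement_one : IsCompactElement (1 : r.RIdeal) :=
  princ_one (r := r) ▸ isCompactElement_princ 1

theorem isCompactElement_mul {I J : r.RIdeal} (hI : IsCompactElement I)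
    (hJ : IsCompactElement J) : IsCompactElement (I * J) := by
  obtain ⟨E, hE, rfl⟩ := isCompactElement_iff.1 hI
  obtain ⟨F, hF, rfl⟩ := isCompactElement_iff.1 hJ
  rw [span_mul_span]
  exact isCompactElement_span (hE.mul hF)

theorem isCompactElement_pow {I : r.RIdeal} (hI : IsCompactElement I) (n : ℕ) :
    IsCompactElement (I ^ n) := by
  induction n with
  | zero => simpa using isCompactElement_one
  | succ n ih => rw [pow_succ]; exact isCompactElement_mul ih hI

theorem isCompactElement_sup {I J : r.RIdeal} (hI : IsCompactElement I)
    (hJ : IsCompactElement J) : IsCompactElement (I ⊔ J) := by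
  obtain ⟨E, hE, rfl⟩ := isCompactElement_iff.1 hI
  obtain ⟨F, hF, rfl⟩ := isCompactElement_iff.1 hJ
  have : r.span E ⊔ r.span F = r.span (E ∪ F) := r.spanGI.gc.l_sup.symm
  rw [this]
  exact isCompactElement_span (hE.union hF)

/-- If `A ⊔ B = 1`, then `A` may be replaced by a compact element below it. -/
theorem exists_isCompactElement_sup_eq_one {A B : r.RIdeal} (h : A ⊔ B = 1) :
    ∃ E ≤ A, IsCompactElement E ∧ E ⊔ B = 1 := by
  have h1 : (1 : H) ∈ r.span (A.carrier ∪ B.carrier) := by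
    rw [← sup_eq_span, h]; exact mem_one 1
  obtain ⟨F, hF, hfin, h1⟩ := exists_finite_of_mem_span h1
  refine ⟨r.span (F ∩ A.carrier), span_le.2 fun x hx => hx.2,
    isCompactElement_span (hfin.inter_of_left _), eq_one_iff.2 ?_⟩
  refine (span_le.2 fun x hx => ?_ : r.span F ≤ _) h1
  rcases hF hx with h | h
  · exact (le_sup_left : _ ≤ r.span (F ∩ A.carrier) ⊔ B) (subset_span ⟨hx, h⟩)
  · exact (le_sup_right : _ ≤ r.span (F ∩ A.carrier) ⊔ B) h

/-! ### Existence of primes -/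

omit hr in
theorem sup_mul_sup_le {A B P : r.RIdeal} (h : A * B ≤ P) : (P ⊔ A) * (P ⊔ B) ≤ P := by
  rw [mul_sup, sup_mul P A B]
  exact sup_le (mul_le_right _ _) (sup_le (mul_le_left _ _) h)

omit hr in
/-- An `r`-ideal that contains no member of a multiplicatively closed set of compact elements
is contained in a prime `r`-ideal with this property. -/
theorem exists_isPrime_of_forall_not_le {S : Set r.RIdeal} (hS : ∀ F ∈ S, IsCompactElement F)
    (h1 : 1 ∈ S) (hmul : ∀ F ∈ S, ∀ G ∈ S, F * G ∈ S) {I : r.RIdeal} (hI : ∀ F ∈ S, ¬ F ≤ I) :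
    ∃ P : r.RIdeal, P.IsPrime ∧ I ≤ P ∧ ∀ F ∈ S, ¬ F ≤ P := by
  -- The supremum of a chain stays in the family because the members of `S` are compact.
  obtain ⟨P, hIP, hP⟩ := zorn_le_nonempty₀ {J : r.RIdeal | ∀ F ∈ S, ¬ F ≤ J}
    (fun c hc hchain J hJ => ⟨sSup c, fun F hF hle => by
      obtain ⟨K, hK, hFK⟩ := hS F hF c (sSup c) ⟨J, hJ⟩ hchain.directedOn (isLUB_sSup c) hle
      exact hc hK F hF hFK, fun K hK => le_sSup hK⟩) I hI
  refine ⟨P, isLPrime_iff_isPrime.1 ⟨fun h => hP.1 1 h1 h.ge, fun A B hAB => ?_⟩, hIP, hP.1⟩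
  by_contra! hc
  have key : ∀ A : r.RIdeal, ¬ A ≤ P → ∃ F ∈ S, F ≤ P ⊔ A := fun A hA => by
    by_contra! h
    exact hA (le_sup_right.trans (hP.2 h le_sup_left))
  obtain ⟨F, hF, hFA⟩ := key A hc.1
  obtain ⟨G, hG, hGB⟩ := key B hc.2
  refine hP.1 _ (hmul F hF G hG) ((mul_le_mul' hFA hGB).trans ?_)
  exact sup_mul_sup_le hAB

/-- The elementwise form of `exists_isPrime_of_forall_not_le`. -/
theorem exists_isPrime_of_disjoint {S : Set H} (h1 : 1 ∈ S)
    (hmul : ∀ x ∈ S, ∀ y ∈ S, x * y ∈ S) {I : r.RIdeal} (hI : ∀ x ∈ S, x ∉ I) :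
    ∃ P : r.RIdeal, P.IsPrime ∧ I ≤ P ∧ ∀ x ∈ S, x ∉ P := by
  have hS : ∀ F ∈ r.princ '' S, IsCompactElement F := by
    rintro _ ⟨x, -, rfl⟩
    exact isCompactElement_princ x
  have hS2 : ∀ F ∈ r.princ '' S, ∀ G ∈ r.princ '' S, F * G ∈ r.princ '' S := by
    rintro _ ⟨x, hx, rfl⟩ _ ⟨y, hy, rfl⟩
    exact ⟨x * y, hmul x hx y hy, princ_mul x y⟩
  have hS3 : ∀ F ∈ r.princ '' S, ¬ F ≤ I := by
    rintro _ ⟨x, hx, rfl⟩ h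
    exact hI x hx (princ_le.1 h)
  obtain ⟨P, hP, hIP, h⟩ := exists_isPrime_of_forall_not_le hS ⟨1, h1, princ_one⟩ hS2 hS3
  exact ⟨P, hP, hIP, fun x hx hxP => h _ ⟨x, hx, rfl⟩ (princ_le.2 hxP)⟩

/-- If no power of `x` lies in `I`, some prime over `I` avoids all powers of `x`; it contains the
radical, hence also its closure, but not `x`. -/
theorem isRIdeal_radical (I : r.RIdeal) : r.IsRIdeal I.radical := by
  refine subset_antisymm (fun x hx => by_contra fun hxI => ?_) (r.subset_closure _)
  have hpow : ∀ n : ℕ, x ^ n ∉ I := fun n hn => hxI ⟨n + 1, by simp, by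
    rw [pow_succ]; exact mul_mem_right hn x⟩
  obtain ⟨P, hP, hIP, h⟩ := exists_isPrime_of_disjoint (S := Set.range (x ^ · : ℕ → H)) (I := I)
    ⟨0, pow_zero x⟩ (by rintro _ ⟨m, rfl⟩ _ ⟨n, rfl⟩; exact ⟨m + n, pow_add x m n⟩)
    (by rintro _ ⟨n, rfl⟩; exact hpow n)
  refine h x ⟨1, pow_one x⟩ ((span_le.2 ?_ : r.span I.radical ≤ P) hx)
  rintro y ⟨n, -, hy⟩
  exact hP.isRadical.mem_of_pow_mem (hIP hy)

/-- The radical of an `r`-ideal as an `r`-ideal. -/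
def rad (I : r.RIdeal) : r.RIdeal := ⟨I.radical, isRIdeal_radical I⟩

theorem mem_rad {I : r.RIdeal} {x : H} : x ∈ rad I ↔ ∃ n : ℕ, 1 ≤ n ∧ x ^ n ∈ I := Iff.rfl

theorem le_rad (I : r.RIdeal) : I ≤ rad I := fun x hx => ⟨1, le_rfl, by simpa using hx⟩

theorem isRadical_rad (I : r.RIdeal) : (rad I).IsRadical := by
  rintro n x hn ⟨m, hm, h⟩
  exact ⟨n * m, Nat.mul_pos hn hm, by rwa [pow_mul]⟩

theorem rad_le {I J : r.RIdeal} (hJ : J.IsRadical) (h : I ≤ J) : rad I ≤ J := by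
  rintro x ⟨n, -, hx⟩
  exact hJ.mem_of_pow_mem (h hx)

/-! ### Maximal `r`-ideals -/

omit hr in
theorem isPrime_of_isCoatom {M : r.RIdeal} (hM : IsCoatom M) : M.IsPrime := by
  refine isLPrime_iff_isPrime.1 ⟨fun h => hM.1 (h.trans one_eq_top), fun A B hAB => ?_⟩
  by_contra! hc
  have key : ∀ A : r.RIdeal, ¬ A ≤ M → M ⊔ A = 1 := fun A hA => by
    rw [one_eq_top]
    exact hM.2 _ (left_lt_sup.2 hA)
  have h := sup_mul_sup_le hAB
  rw [key A hc.1, key B hc.2, mul_one] at h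
  exact hM.1 (top_le_iff.1 (one_eq_top.ge.trans h))

theorem exists_isCoatom_le {I : r.RIdeal} (hI : I ≠ 1) : ∃ M : r.RIdeal, IsCoatom M ∧ I ≤ M := by
  have := CompleteLattice.coatomic_of_top_compact (one_eq_top (r := r) ▸ isCompactElement_one)
  exact (eq_top_or_exists_le_coatom I).resolve_left fun h => hI (h.trans one_eq_top.symm)

omit hr in
theorem maxSpectrum_isCoatom (M : r.MaxSpectrum) : IsCoatom M.1 := by
  obtain ⟨M, -, h1, h2⟩ := M
  refine ⟨fun h => isProper_iff.1 h1 (h.trans one_eq_top.symm), fun I hI => ?_⟩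
  by_contra h
  exact hI.ne (h2 I (isProper_iff.2 fun h' => h (h'.trans one_eq_top)) hI.le).symm

omit hr in
theorem maxSpectrum_isPrime (M : r.MaxSpectrum) : M.1.IsPrime :=
  isPrime_of_isCoatom (maxSpectrum_isCoatom M)

theorem maxSpectrum_ne_bot (M : r.MaxSpectrum) : M.1 ≠ ⊥ := isNontrivial_iff.1 M.2.1

theorem exists_maxSpectrum_le {I : r.RIdeal} (hI : I ≠ 1) (hb : I ≠ ⊥) :
    ∃ M : r.MaxSpectrum, I ≤ M.1 := by
  obtain ⟨M, hM, hIM⟩ := exists_isCoatom_le hI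
  refine ⟨⟨M, isNontrivial_iff.2 fun h => hb (le_bot_iff.1 (h ▸ hIM)), isProper_iff.2 fun h =>
    hM.1 (h.trans one_eq_top), fun J hJ hMJ => ?_⟩, hIM⟩
  by_contra h
  exact isProper_iff.1 hJ ((hM.2 J (hMJ.lt_of_ne' h)).trans one_eq_top.symm)

omit hr in
theorem sup_eq_one_of_not_le (M : r.MaxSpectrum) {A : r.RIdeal} (hA : ¬ A ≤ M.1) :
    M.1 ⊔ A = 1 := by
  rw [one_eq_top]
  exact (maxSpectrum_isCoatom M).2 _ (left_lt_sup.2 hA)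

omit hr in
theorem maxSpectrum_eq_of_le {M N : r.MaxSpectrum} (h : M.1 ≤ N.1) : M = N :=
  Subtype.ext ((maxSpectrum_isCoatom M).le_iff.1 h |>.resolve_left
    (maxSpectrum_isCoatom N).1).symm

/-! ### Invertible ideals -/

theorem isInvertible_iff {I : r.RIdeal} :
    r.IsInvertible I.carrier ↔ ∃ (J : r.RIdeal) (y : H), y ∉ zeroElements H ∧
      I * J = r.princ y := by
  have hp : ∀ y : H, (r.princ y).carrier = y • (Set.univ : Set H) := fun y => by
    ext z
    rw [mem_carrier, mem_princ]
    simp [Set.mem_smul_set, eq_comm]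
  constructor
  · rintro ⟨J, y, hy, h⟩
    refine ⟨r.span J, y, isRegularElement_iff.1 hy, ?_⟩
    rw [← span_carrier I, span_mul_span]
    exact Subtype.ext (h.trans (hp y).symm)
  · rintro ⟨J, y, hy, h⟩
    exact ⟨J.carrier, y, isRegularElement_iff.2 hy, (congrArg RIdeal.carrier h).trans (hp y)⟩

theorem isInvertible_princ {x : H} (hx : x ∉ zeroElements H) :
    r.IsInvertible (r.princ x).carrier :=
  isInvertible_iff.2 ⟨1, x, hx, mul_one _⟩

theorem isInvertible_left_of_mul {I J : r.RIdeal} (h : r.IsInvertible (I * J).carrier) :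
    r.IsInvertible I.carrier := by
  obtain ⟨K, y, hy, h⟩ := isInvertible_iff.1 h
  exact isInvertible_iff.2 ⟨J * K, y, hy, by rwa [← mul_assoc]⟩

theorem isInvertible_of_mem_of_prod {l : List r.RIdeal} (h : r.IsInvertible l.prod.carrier)
    {I : r.RIdeal} (hI : I ∈ l) : r.IsInvertible I.carrier := by
  obtain ⟨J, hJ⟩ := exists_mul_eq_prod hI
  exact isInvertible_left_of_mul (hJ ▸ h)

theorem isInvertible_ne_bot {I : r.RIdeal} (h : r.IsInvertible I.carrier) : I ≠ ⊥ := by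
  rintro rfl
  obtain ⟨J, y, hy, h⟩ := isInvertible_iff.1 h
  rw [bot_mul'] at h
  exact princ_ne_bot hy h.symm

/-- Finitely many products from `I * J` already generate `y`. Their first factors span some `I' ≤ I`
with `y I ≤ I' J I = y I'`, and `y` cancels. -/
theorem isCompactElement_of_isInvertible {I : r.RIdeal} (h : r.IsInvertible I.carrier) :
    IsCompactElement I := by
  obtain ⟨J, y, hy, h⟩ := isInvertible_iff.1 h
  have hyIJ : y ∈ r.span (I.carrier * J.carrier) := by
    have : y ∈ I * J := h ▸ mem_princ_self y
    exact this
  obtain ⟨E, hE, hfin, hyE⟩ := exists_finite_of_mem_span hyIJ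
  choose! f hf g hg hfg using hE
  have hle : r.span (f '' E) ≤ I := span_le.2 <| by rintro _ ⟨x, hx, rfl⟩; exact hf hx
  suffices I ≤ r.span (f '' E) from
    this.antisymm hle ▸ isCompactElement_span (hfin.image f)
  have hy1 : r.princ y ≤ r.span (f '' E) * J := princ_le.2 <|
    (span_le.2 fun x hx => hfg hx ▸ mul_mem_mul (subset_span ⟨x, hx, rfl⟩) (hg hx) :
      r.span E ≤ _) hyE
  refine princ_mul_cancel hy ?_
  calc r.princ y * I ≤ r.span (f '' E) * J * I := mul_le_mul_left hy1 I
    _ = r.princ y * r.span (f '' E) := by rw [mul_assoc, mul_comm J, h, mul_comm]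

end WeakIdealSystem

namespace WeakIdealSystem

variable {H : Type u} [CommMonoid H] {r : WeakIdealSystem H} [hr : r.IsCancellativeSystem]

/-! ### Localization at maximal `r`-ideals -/

/-- The contraction `I_M ∩ H` of the localization of `I` at `M`. -/
def loc (M : r.MaxSpectrum) (I : r.RIdeal) : r.RIdeal := r.span {x | ∃ s ∉ M.1, s * x ∈ I}

omit hr in
theorem one_notMem_max (M : r.MaxSpectrum) : (1 : H) ∉ M.1 := (maxSpectrum_isPrime M).one_notMem

omit hr in
theorem mul_notMem_max (M : r.MaxSpectrum) {s t : H} (hs : s ∉ M.1) (ht : t ∉ M.1) :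
    s * t ∉ M.1 := (maxSpectrum_isPrime M).mul_notMem hs ht

/-- The defining set is already closed: by finitarity only finitely many denominators matter, and
their product serves for all. -/
theorem mem_loc {M : r.MaxSpectrum} {I : r.RIdeal} {x : H} :
    x ∈ loc M I ↔ ∃ s ∉ M.1, s * x ∈ I := by
  refine ⟨fun hx => ?_, fun h => subset_span h⟩
  obtain ⟨E, hE, hfin, hx⟩ := exists_finite_of_mem_span hx
  have key : ∃ s ∉ M.1, ∀ y ∈ E, s * y ∈ I := by
    clear hx
    induction E, hfin using Set.Finite.induction_on with
    | empty => exact ⟨1, one_notMem_max M, by simp⟩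
    | @insert a E _ _ ih =>
      obtain ⟨s, hs, h⟩ := ih ((Set.subset_insert _ _).trans hE)
      obtain ⟨t, ht, hta⟩ := hE (Set.mem_insert a E)
      refine ⟨s * t, mul_notMem_max M hs ht, fun y hy => ?_⟩
      rcases Set.mem_insert_iff.1 hy with rfl | hy
      · rw [mul_assoc]; exact mul_mem_left _ hta
      · rw [mul_right_comm]; exact mul_mem_right (h y hy) t
  obtain ⟨s, hs, h⟩ := key
  refine ⟨s, hs, ?_⟩
  have : x ∈ colon I {s} :=
    (span_le.2 fun y hy => mem_colon_singleton.2 (mul_comm s y ▸ h y hy) : r.span E ≤ _) hx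
  rw [mul_comm]
  exact mem_colon_singleton.1 this

variable {M : r.MaxSpectrum} {I J K : r.RIdeal}

theorem le_loc (M : r.MaxSpectrum) (I : r.RIdeal) : I ≤ loc M I := fun x hx =>
  mem_loc.2 ⟨1, one_notMem_max M, by rwa [one_mul]⟩

theorem mem_loc_of_mul_mem {s x : H} (hs : s ∉ M.1) (h : s * x ∈ loc M I) : x ∈ loc M I := by
  obtain ⟨t, ht, h⟩ := mem_loc.1 h
  exact mem_loc.2 ⟨t * s, mul_notMem_max M ht hs, by rwa [mul_assoc]⟩

theorem loc_le_loc_iff : loc M I ≤ loc M J ↔ I ≤ loc M J := by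
  refine ⟨(le_loc M I).trans, fun h x hx => ?_⟩
  obtain ⟨s, hs, hx⟩ := mem_loc.1 hx
  exact mem_loc_of_mul_mem hs (h hx)

theorem loc_mono (h : I ≤ J) : loc M I ≤ loc M J := loc_le_loc_iff.2 (h.trans (le_loc M J))

theorem le_loc_trans (h1 : I ≤ loc M J) (h2 : J ≤ loc M K) : I ≤ loc M K :=
  h1.trans (loc_le_loc_iff.2 h2)

theorem mul_le_loc {I' J' : r.RIdeal} (hI : I ≤ loc M I') (hJ : J ≤ loc M J') :
    I * J ≤ loc M (I' * J') := by
  refine mul_le.2 fun x hx y hy => ?_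
  obtain ⟨s, hs, hx⟩ := mem_loc.1 (hI hx)
  obtain ⟨t, ht, hy⟩ := mem_loc.1 (hJ hy)
  exact mem_loc.2 ⟨s * t, mul_notMem_max M hs ht, by
    rw [mul_mul_mul_comm]; exact mul_mem_mul hx hy⟩

theorem mul_le_loc_left (K : r.RIdeal) (hI : I ≤ loc M J) : I * K ≤ loc M (J * K) :=
  mul_le_loc hI (le_loc M K)

theorem pow_le_loc (hI : I ≤ loc M J) (n : ℕ) : I ^ n ≤ loc M (J ^ n) := by
  induction n with
  | zero => simpa using le_loc M 1
  | succ n ih => rw [pow_succ, pow_succ]; exact mul_le_loc ih hI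

theorem mem_loc_of_notMem {s x : H} (hs : s ∉ M.1) (h : s ∈ I) : x ∈ loc M I :=
  mem_loc.2 ⟨s, hs, mul_mem_right h x⟩

theorem loc_eq_one (h : ¬ I ≤ M.1) : loc M I = 1 := by
  obtain ⟨s, hs, hsM⟩ := Set.not_subset.1 h
  exact eq_one_iff.2 (mem_loc_of_notMem hsM hs)

theorem loc_le_of_isPrime {P : r.RIdeal} (hP : P.IsPrime) (h : P ≤ M.1) : loc M P ≤ P := by
  intro x hx
  obtain ⟨s, hs, hx⟩ := mem_loc.1 hx
  exact (hP.mem_or_mem hx).resolve_left fun h' => hs (h h')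

theorem loc_le_max (h : I ≤ M.1) : loc M I ≤ M.1 :=
  (loc_mono h).trans (loc_le_of_isPrime (maxSpectrum_isPrime M) le_rfl)

theorem isRadical_loc (h : I.IsRadical) : (loc M I).IsRadical := by
  intro n x hn hx
  obtain ⟨s, hs, hx⟩ := mem_loc.1 hx
  refine mem_loc.2 ⟨s, hs, h.mem_of_pow_mem (n := n) ?_⟩
  obtain ⟨k, rfl⟩ := Nat.exists_eq_add_of_le' hn
  rw [mul_pow, pow_succ s, mul_assoc]
  exact mul_mem_left _ hx

/-- A common denominator exists for finitely many generators. This lets an inclusion at `M` spread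
to the maximal `r`-ideals near `M`. -/
theorem exists_mul_le_of_isCompactElement {E : r.RIdeal} (hE : IsCompactElement E)
    (h : E ≤ loc M I) : ∃ s ∉ M.1, r.princ s * E ≤ I := by
  obtain ⟨F, hF, rfl⟩ := isCompactElement_iff.1 hE
  have hF' : ∀ x ∈ F, ∃ J ∈ Set.range (fun s : {s // s ∉ M.1} => colon I {s.1}), x ∈ J := by
    intro x hx
    obtain ⟨s, hs, hx⟩ := mem_loc.1 (h (subset_span hx))
    exact ⟨_, ⟨⟨s, hs⟩, rfl⟩, mem_colon_singleton.2 (mul_comm s x ▸ hx)⟩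
  have hd : DirectedOn (· ≤ ·) (Set.range (fun s : {s // s ∉ M.1} => colon I {s.1})) := by
    rintro _ ⟨⟨s, hs⟩, rfl⟩ _ ⟨⟨t, ht⟩, rfl⟩
    refine ⟨_, ⟨⟨s * t, mul_notMem_max M hs ht⟩, rfl⟩, fun x hx => ?_, fun x hx => ?_⟩ <;>
      have hx := mem_colon_singleton.1 hx <;> refine mem_colon_singleton.2 ?_
    · rw [← mul_assoc]; exact mul_mem_right hx t
    · rw [mul_left_comm]; exact mul_mem_left s hx
  obtain ⟨_, ⟨⟨s, hs⟩, rfl⟩, hJ⟩ :=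
    exists_forall_mem_of_finite (Set.range_nonempty_iff_nonempty.2 ⟨1, one_notMem_max M⟩) hd hF hF'
  refine ⟨s, hs, mul_le.2 fun t ht x hx => ?_⟩
  obtain ⟨u, rfl⟩ := mem_princ.1 ht
  have hx' := mem_colon_singleton.1 ((span_le.2 hJ : r.span F ≤ colon I {s}) hx)
  rw [mul_right_comm, mul_comm s x]
  exact mul_mem_right hx' u

/-- Equality of a nontrivial `r`-ideal with another one is a local property. -/
theorem le_of_forall_le_loc (hJ : J ≠ ⊥) (h : ∀ M : r.MaxSpectrum, I ≤ loc M J) : I ≤ J := by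
  intro x hx
  have h1 : colon J {x} = 1 := by
    by_contra hne
    -- The residual contains `J ≠ ⊥`, so the maximal `r`-ideal above it is nontrivial.
    obtain ⟨M, hM⟩ := exists_maxSpectrum_le hne fun hb => hJ (le_bot_iff.1 (hb ▸ le_colon_self J _))
    obtain ⟨s, hs, hsx⟩ := mem_loc.1 (h M hx)
    exact hs (hM (mem_colon_singleton.2 hsx))
  exact one_mul x ▸ mem_colon_singleton.1 (eq_one_iff.1 h1)

/-- An `r`-invertible `r`-ideal is locally principal. -/
theorem exists_le_loc_princ (M : r.MaxSpectrum) (hI : r.IsInvertible I.carrier) :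
    ∃ x ∈ I, x ∉ zeroElements H ∧ I ≤ loc M (r.princ x) := by
  obtain ⟨J, y, hy, h⟩ := isInvertible_iff.1 hI
  -- Some product `i * j = y * s` has `s ∉ M`. For `k ∈ I` with `k * j = y * t`, cancelling `y`
  -- gives `s * k = i * t`, so `i` generates `I` locally.
  have hne : ¬ I * J ≤ r.princ y * M.1 := fun hle => by
    have : r.princ y * 1 ≤ r.princ y * M.1 := by rw [mul_one]; exact h ▸ hle
    exact one_notMem_max M (princ_mul_cancel hy this (mem_one 1))
  rw [mul_le] at hne
  push Not at hne
  obtain ⟨i, hi, j, hj, hij⟩ := hne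
  obtain ⟨s, hs⟩ := mem_princ.1 (h ▸ mul_mem_mul hi hj : i * j ∈ r.princ y)
  have hsM : s ∉ M.1 := fun hsM => hij (hs ▸ (mul_mem_princ_mul hy).2 hsM)
  refine ⟨i, hi, fun hi0 => hij (mul_mem_right (mem_of_mem_zeroElements hi0) j), fun k hk => ?_⟩
  obtain ⟨t, ht⟩ := mem_princ.1 (h ▸ mul_mem_mul hk hj : k * j ∈ r.princ y)
  refine mem_loc.2 ⟨s, hsM, mem_princ.2 ⟨t, mul_left_cancel_of_nonzero r hy ?_⟩⟩
  calc y * (s * k) = k * (y * s) := by rw [← mul_assoc, mul_comm]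
    _ = i * (k * j) := by rw [← hs, mul_left_comm]
    _ = y * (i * t) := by rw [ht, mul_left_comm]

/-! ### Discrete valuations -/

/-- The localization at `M` is a discrete valuation monoid. -/
def IsDiscreteAt (M : r.MaxSpectrum) : Prop :=
  (∀ I : r.RIdeal, I ≠ ⊥ → ∃ n : ℕ, loc M I = loc M (M.1 ^ n)) ∧
    StrictAnti fun n : ℕ => loc M (M.1 ^ n)

theorem nonzero_of_max_le {p : H} (hM : M.1 ≤ loc M (r.princ p)) : p ∉ zeroElements H :=
  fun hp0 => maxSpectrum_ne_bot M <| le_bot_iff.1 <| by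
    have hb : r.princ p ≤ ⊥ := princ_le.2 (mem_of_mem_zeroElements hp0)
    exact (hM.trans (loc_mono hb)).trans (loc_le_of_isPrime isPrime_bot bot_le)

theorem pow_notMem_loc_princ_pow_succ {p : H} (hp : p ∈ M.1) (hp0 : p ∉ zeroElements H) (n : ℕ) :
    p ^ n ∉ loc M (r.princ (p ^ (n + 1))) := fun hle => by
  obtain ⟨s, hs, h⟩ := mem_loc.1 hle
  obtain ⟨t, ht⟩ := mem_princ.1 h
  rw [pow_succ, mul_comm, mul_assoc] at ht
  have := mul_left_cancel_of_nonzero r (pow_nonzero r hp0 n) ht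
  exact hs (this ▸ mul_mem_right hp t)

/-- Take the largest `n` such that `p ^ n` divides `x` locally. The cofactor is outside `M`, since
otherwise it would be locally divisible by `p`. -/
theorem exists_mul_eq_pow_mul {p : H} (hM : M.1 ≤ loc M (r.princ p)) {x : H}
    (h : ∃ n : ℕ, x ∉ loc M (r.princ (p ^ n))) :
    ∃ n : ℕ, ∃ s ∉ M.1, ∃ t ∉ M.1, s * x = p ^ n * t := by
  classical
  obtain ⟨n, hn⟩ : ∃ n, Nat.find h = n + 1 := Nat.exists_eq_succ_of_ne_zero fun h0 => by
    have := Nat.find_spec h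
    rw [h0, pow_zero, princ_one] at this
    exact this (le_loc M 1 (mem_one x))
  have h1 : x ∉ loc M (r.princ (p ^ (n + 1))) := hn ▸ Nat.find_spec h
  have h2 : x ∈ loc M (r.princ (p ^ n)) := not_not.1 (Nat.find_min h (by omega))
  obtain ⟨s, hs, hsx⟩ := mem_loc.1 h2
  obtain ⟨t, ht⟩ := mem_princ.1 hsx
  refine ⟨n, s, hs, t, fun htM => h1 ?_, ht⟩
  obtain ⟨u, hu, hut⟩ := mem_loc.1 (hM htM)
  obtain ⟨v, hv⟩ := mem_princ.1 hut
  refine mem_loc.2 ⟨u * s, mul_notMem_max M hu hs, mem_princ.2 ⟨v, ?_⟩⟩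
  rw [mul_assoc, ht, mul_left_comm, hv, pow_succ, mul_assoc]

/-- Every nonzero element is locally a unit times a power of `p`, so a nontrivial `r`-ideal is
locally generated by an element of least exponent. -/
theorem isDiscreteAt_of_le_loc_princ {p : H} (hp : p ∈ M.1) (hM : M.1 ≤ loc M (r.princ p))
    (h : ∀ x ∉ zeroElements H, ∃ n : ℕ, x ∉ loc M (r.princ (p ^ n))) : IsDiscreteAt M := by
  have hp0 := nonzero_of_max_le hM
  have hpow : ∀ n : ℕ, loc M (M.1 ^ n) = loc M (r.princ (p ^ n)) := fun n => by
    rw [princ_pow]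
    exact le_antisymm (loc_le_loc_iff.2 (pow_le_loc hM n))
      (loc_mono (pow_le_pow_left' (princ_le.2 hp) n))
  have hx : ∀ x ∉ zeroElements H, ∃ n : ℕ, loc M (r.princ x) = loc M (M.1 ^ n) := by
    intro x hx
    obtain ⟨n, s, hs, t, ht, hst⟩ := exists_mul_eq_pow_mul hM (h x hx)
    refine ⟨n, (hpow n).symm ▸ le_antisymm (loc_le_loc_iff.2 (princ_le.2 ?_))
      (loc_le_loc_iff.2 (princ_le.2 ?_))⟩
    · exact mem_loc.2 ⟨s, hs, mem_princ.2 ⟨t, hst⟩⟩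
    · exact mem_loc.2 ⟨t, ht, mem_princ.2 ⟨s, by rw [mul_comm, ← hst, mul_comm]⟩⟩
  refine ⟨fun I hI => ?_, strictAnti_nat_of_succ_lt fun n => ?_⟩
  · classical
    have hex : ∃ n : ℕ, ∃ x ∈ I, x ∉ zeroElements H ∧ loc M (r.princ x) = loc M (M.1 ^ n) := by
      obtain ⟨x, hxI, hx0⟩ := ne_bot_iff.1 hI
      obtain ⟨n, hn⟩ := hx x hx0
      exact ⟨n, x, hxI, hx0, hn⟩
    obtain ⟨x, hxI, -, hxn⟩ := Nat.find_spec hex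
    refine ⟨Nat.find hex, le_antisymm (loc_le_loc_iff.2 fun y hy => ?_)
      (hxn ▸ loc_mono (princ_le.2 hxI))⟩
    by_cases hy0 : y ∈ zeroElements H
    · exact mem_of_mem_zeroElements hy0
    · obtain ⟨m, hm⟩ := hx y hy0
      refine loc_mono (pow_le_pow_right_of_le_one' (le_one _) (Nat.find_min' hex ⟨y, hy, hy0, hm⟩))
        (hm ▸ le_loc M _ (mem_princ_self y))
  · refine lt_of_le_not_ge (loc_mono (pow_le_pow_right_of_le_one' (le_one _) n.le_succ)) fun hle => ?_
    rw [hpow, hpow, loc_le_loc_iff, princ_le] at hle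
    exact pow_notMem_loc_princ_pow_succ hp hp0 n hle

/-- An `x` that locally divides `p ^ n` is not divisible by `p ^ (n + 1)`, since `p ^ n` is not. -/
theorem isDiscreteAt_of_pow_mem {p : H} (hp : p ∈ M.1) (hM : M.1 ≤ loc M (r.princ p))
    (h : ∀ x ∉ zeroElements H, ∃ n : ℕ, p ^ n ∈ loc M (r.princ x)) : IsDiscreteAt M := by
  have hp0 := nonzero_of_max_le hM
  refine isDiscreteAt_of_le_loc_princ hp hM fun x hx => ?_
  obtain ⟨n, hn⟩ := h x hx
  refine ⟨n + 1, fun hx' => ?_⟩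
  exact pow_notMem_loc_princ_pow_succ hp hp0 n (loc_le_loc_iff.2 (princ_le.2 hx') hn)

end WeakIdealSystem

/-! ### Almost Dedekind monoids and their values -/

namespace WeakIdealSystem

variable {H : Type u} [CommMonoid H] {r : WeakIdealSystem H} [hr : r.IsCancellativeSystem]

/-- All localizations at nontrivial maximal `r`-ideals are discrete valuation monoids. -/
class IsAlmostDedekind (r : WeakIdealSystem H) [r.IsCancellativeSystem] : Prop where
  isDiscreteAt : ∀ M : r.MaxSpectrum, IsDiscreteAt M

/-- The value of an `r`-ideal at `M`. -/
noncomputable def val (M : r.MaxSpectrum) (I : r.RIdeal) : ℕ :=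
  -- The value is meaningful only for `I ≠ ⊥`; for `⊥` it is arbitrary.
  Classical.epsilon fun n => loc M I = loc M (M.1 ^ n)

variable [hD : r.IsAlmostDedekind] {M : r.MaxSpectrum} {I J : r.RIdeal}

theorem loc_eq_loc_pow_val (M : r.MaxSpectrum) (hI : I ≠ ⊥) :
    loc M I = loc M (M.1 ^ val M I) :=
  Classical.epsilon_spec ((hD.isDiscreteAt M).1 I hI)

theorem loc_pow_le_loc_pow {m n : ℕ} : loc M (M.1 ^ m) ≤ loc M (M.1 ^ n) ↔ n ≤ m :=
  (hD.isDiscreteAt M).2.le_iff_ge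

theorem loc_le_loc_iff_val (hI : I ≠ ⊥) (hJ : J ≠ ⊥) : loc M I ≤ loc M J ↔ val M J ≤ val M I := by
  rw [loc_eq_loc_pow_val M hI, loc_eq_loc_pow_val M hJ, loc_pow_le_loc_pow]

theorem le_loc_iff_val (hI : I ≠ ⊥) (hJ : J ≠ ⊥) : I ≤ loc M J ↔ val M J ≤ val M I := by
  rw [← loc_le_loc_iff, loc_le_loc_iff_val hI hJ]

theorem val_eq_of_loc_eq {n : ℕ} (hI : I ≠ ⊥) (h : loc M I = loc M (M.1 ^ n)) : val M I = n :=
  (hD.isDiscreteAt M).2.injective ((loc_eq_loc_pow_val M hI).symm.trans h)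

theorem val_max_pow (M : r.MaxSpectrum) (n : ℕ) : val M (M.1 ^ n) = n :=
  val_eq_of_loc_eq (pow_ne_bot (maxSpectrum_ne_bot M) n) rfl

theorem val_one (M : r.MaxSpectrum) : val M (1 : r.RIdeal) = 0 := by
  simpa using val_max_pow M 0

theorem val_mul (M : r.MaxSpectrum) (hI : I ≠ ⊥) (hJ : J ≠ ⊥) :
    val M (I * J) = val M I + val M J := by
  refine val_eq_of_loc_eq (mul_ne_bot hI hJ) (le_antisymm ?_ ?_) <;> rw [loc_le_loc_iff, pow_add]
  · exact mul_le_loc (loc_le_loc_iff.1 (loc_eq_loc_pow_val M hI).le)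
      (loc_le_loc_iff.1 (loc_eq_loc_pow_val M hJ).le)
  · exact mul_le_loc (loc_le_loc_iff.1 (loc_eq_loc_pow_val M hI).ge)
      (loc_le_loc_iff.1 (loc_eq_loc_pow_val M hJ).ge)

theorem val_pow (M : r.MaxSpectrum) (hI : I ≠ ⊥) (n : ℕ) : val M (I ^ n) = n * val M I := by
  induction n with
  | zero => simp [val_one]
  | succ n ih => rw [pow_succ, val_mul M (pow_ne_bot hI n) hI, ih, add_mul, one_mul]

omit hr hD in
theorem ne_bot_of_le (h : I ≤ J) (hI : I ≠ ⊥) : J ≠ ⊥ := fun hJ => hI (le_bot_iff.1 (hJ ▸ h))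

theorem val_anti (hI : I ≠ ⊥) (h : I ≤ J) : val M J ≤ val M I :=
  (le_loc_iff_val hI (ne_bot_of_le h hI)).1 (h.trans (le_loc M J))

theorem le_iff_val (hI : I ≠ ⊥) (hJ : J ≠ ⊥) :
    I ≤ J ↔ ∀ M : r.MaxSpectrum, val M J ≤ val M I :=
  ⟨fun h _ => val_anti hI h, fun h =>
    le_of_forall_le_loc hJ fun M => (le_loc_iff_val hI hJ).2 (h M)⟩

theorem eq_of_val_eq (hI : I ≠ ⊥) (hJ : J ≠ ⊥)
    (h : ∀ M : r.MaxSpectrum, val M I = val M J) : I = J :=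
  le_antisymm ((le_iff_val hI hJ).2 fun M => (h M).ge) ((le_iff_val hJ hI).2 fun M => (h M).le)

theorem one_le_val_iff (hI : I ≠ ⊥) : 1 ≤ val M I ↔ I ≤ M.1 := by
  have h := le_loc_iff_val (M := M) hI (maxSpectrum_ne_bot M)
  rw [← pow_one M.1, val_max_pow, pow_one] at h
  rw [← h]
  exact ⟨fun h => h.trans (loc_le_max le_rfl), fun h => h.trans (le_loc M _)⟩

/-- The localization of `I` is radical and contains a power of `M`, hence contains `M`. -/
theorem val_le_one_of_isRadical (hI : I ≠ ⊥) (h : I.IsRadical) : val M I ≤ 1 := by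
  have h1 : M.1 ≤ loc M I := (isRadical_loc h).le_of_pow_le (n := val M I)
    (loc_le_loc_iff.1 (loc_eq_loc_pow_val M hI).ge)
  have h2 := (le_loc_iff_val (maxSpectrum_ne_bot M) hI).1 h1
  rwa [← pow_one M.1, val_max_pow] at h2

/-- In an almost Dedekind monoid every nontrivial prime `r`-ideal is maximal. -/
theorem max_le_of_isPrime {P : r.RIdeal} (hP : P.IsPrime) (hb : P ≠ ⊥) (h : P ≤ M.1) :
    M.1 ≤ P :=
  hP.le_of_pow_le <| (le_loc M _).trans <|
    (loc_eq_loc_pow_val M hb).ge.trans (loc_le_of_isPrime hP h)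

theorem dim_le_one : r.dim ≤ 1 := by
  refine Order.krullDim_le_one_iff.2 fun P => ?_
  rw [or_iff_not_imp_left]
  intro hmin Q hPQ
  have hQ := isLPrime_iff_isPrime.1 Q.2
  have hP := isLPrime_iff_isPrime.1 P.2
  have hb : P.1 ≠ ⊥ := fun hb => hmin fun Q _ => by
    change P.1 ≤ Q.1
    rw [hb]; exact bot_le
  obtain ⟨M, hM⟩ := exists_maxSpectrum_le hQ.ne_one (ne_bot_of_le hPQ hb)
  exact hM.trans (max_le_of_isPrime hP hb (le_trans hPQ hM))

omit hr hD in
theorem colon_ne_bot (hI : I ≠ ⊥) (S : Set H) : colon I S ≠ ⊥ := ne_bot_of_le (le_colon_self I S) hI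

/-- Compact `r`-ideals are locally principal, whence `r`-invertible. -/
theorem mul_colon_eq_princ {E : r.RIdeal} (hE : IsCompactElement E) {x : H} (hx : x ∈ E)
    (hx0 : x ∉ zeroElements H) : E * colon (r.princ x) E.carrier = r.princ x := by
  have hE0 := ne_bot_of_mem hx hx0
  refine le_antisymm ?_ (le_of_forall_le_loc
    (mul_ne_bot hE0 (colon_ne_bot (princ_ne_bot hx0) _)) fun M => ?_)
  · rw [mul_comm]; exact le_colon.1 le_rfl
  · have hle : val M E ≤ val M (r.princ x) := val_anti (princ_ne_bot hx0) (princ_le.2 hx)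
    obtain ⟨k, hk⟩ := Nat.exists_eq_add_of_le hle
    have hxM := loc_eq_loc_pow_val M (princ_ne_bot (r := r) hx0)
    have hEM := loc_eq_loc_pow_val M hE0
    -- Locally `E` is `M ^ val M E` and `(x)` is `M ^ (val M E + k)`, so the residual must contain
    -- `M ^ k` locally; compactness of `E` provides the denominator.
    have h1 : M.1 ^ k ≤ loc M (colon (r.princ x) E.carrier) := fun z hz => by
      have h2 : r.princ z * E ≤ loc M (r.princ x) := by
        refine le_loc_trans (mul_le_loc (I' := M.1 ^ k) (J' := M.1 ^ val M E)
          ((princ_le.2 hz).trans (le_loc M _)) (loc_le_loc_iff.1 hEM.le)) ?_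
        rw [← pow_add, add_comm, ← hk]
        exact loc_le_loc_iff.1 hxM.ge
      obtain ⟨s, hs, h⟩ := exists_mul_le_of_isCompactElement
        (isCompactElement_mul (isCompactElement_princ z) hE) h2
      refine mem_loc.2 ⟨s, hs, princ_le.1 ?_⟩
      rw [le_colon, princ_mul, mul_assoc]
      exact h
    refine le_loc_trans (loc_le_loc_iff.1 hxM.le) ?_
    rw [hk, pow_add]
    exact mul_le_loc (loc_le_loc_iff.1 hEM.ge) h1

theorem isInvertible_of_isCompactElement {E : r.RIdeal} (hE : IsCompactElement E) (hb : E ≠ ⊥) :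
    r.IsInvertible E.carrier := by
  obtain ⟨x, hx, hx0⟩ := ne_bot_iff.1 hb
  exact isInvertible_iff.2 ⟨_, x, hx0, mul_colon_eq_princ hE hx hx0⟩

/-! ### The inverse topology -/

/-- The basic open set of all maximal `r`-ideals that contain `E`. -/
def zeroLocus (E : r.RIdeal) : Set r.MaxSpectrum := {M | E ≤ M.1}

omit hr hD in
theorem isOpen_zeroLocus {E : r.RIdeal} (hE : IsCompactElement E) : IsOpen (zeroLocus E) :=
  TopologicalSpace.isOpen_generateFrom_of_mem ⟨E, hE, rfl⟩

omit hD in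
theorem exists_zeroLocus_subset {U : Set r.MaxSpectrum} (hU : IsOpen U) (hM : M ∈ U) :
    ∃ E : r.RIdeal, IsCompactElement E ∧ E ≤ M.1 ∧ zeroLocus E ⊆ U := by
  induction hU with
  | basic V hV =>
    obtain ⟨E, hE, rfl⟩ := hV
    exact ⟨E, hE, hM, subset_rfl⟩
  | univ => exact ⟨r.princ _, isCompactElement_princ _,
      princ_le.2 (ne_bot_iff.1 (maxSpectrum_ne_bot M)).choose_spec.1, Set.subset_univ _⟩
  | inter V W _ _ hV hW =>
    obtain ⟨E, hE, hEM, hEV⟩ := hV hM.1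
    obtain ⟨F, hF, hFM, hFW⟩ := hW hM.2
    exact ⟨E ⊔ F, isCompactElement_sup hE hF, sup_le hEM hFM, fun N hN =>
      ⟨hEV (le_sup_left.trans hN : E ≤ N.1), hFW (le_sup_right.trans hN : F ≤ N.1)⟩⟩
  | sUnion S _ h =>
    obtain ⟨V, hV, hMV⟩ := hM
    obtain ⟨E, hE, hEM, hEV⟩ := h V hV hMV
    exact ⟨E, hE, hEM, hEV.trans (Set.subset_sUnion_of_mem hV)⟩

-- If `I` is not below `M`, then `M ⊔ I = 1`, and already `E ⊔ I = 1` for some compact `E ≤ M`. The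
-- open set of `E` contains `M` and misses the zero locus of `I`.
omit hD in
theorem isClosed_zeroLocus (I : r.RIdeal) : IsClosed (zeroLocus I) := by
  refine isOpen_compl_iff.1 (isOpen_iff_forall_mem_open.2 fun M hM => ?_)
  obtain ⟨E, hEM, hE, h⟩ := exists_isCompactElement_sup_eq_one (sup_eq_one_of_not_le M hM)
  exact ⟨zeroLocus E, fun N hN hN' => (maxSpectrum_isPrime N).ne_one
    ((le_one _).antisymm (h.ge.trans (sup_le hN hN'))), isOpen_zeroLocus hE, hEM⟩

/-- By Alexander's subbase theorem only covers by sets `zeroLocus F` matter. Compact `F` with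
finitely covered zero locus are closed under products, so without a finite subcover a prime over `I`
avoids them. It is nontrivial, hence maximal, yet it contains an `F` from the cover. -/
theorem isCompact_zeroLocus (hI : I ≠ ⊥) : IsCompact (zeroLocus I) := by
  refine isCompact_generateFrom rfl fun P hP hcov => ?_
  by_contra! hfin
  let S : Set r.RIdeal := {F | IsCompactElement F ∧
    ∃ Q ⊆ P, Q.Finite ∧ zeroLocus F ⊆ ⋃₀ Q}
  obtain ⟨p, hp, hIp, hS⟩ := exists_isPrime_of_forall_not_le (S := S) (I := I)
    (fun F hF => hF.1)
    ⟨isCompactElement_one, ∅, Set.empty_subset _, Set.finite_empty, fun M hM =>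
      absurd ((le_one _).antisymm hM) (maxSpectrum_isPrime M).ne_one⟩
    (fun F ⟨hF, Q, hQ, hQf, hFQ⟩ G ⟨hG, R, hR, hRf, hGR⟩ => ⟨isCompactElement_mul hF hG, Q ∪ R,
      Set.union_subset hQ hR, hQf.union hRf, fun M hM => by
        rw [Set.sUnion_union]
        exact ((maxSpectrum_isPrime M).le_or_le hM).imp (fun h => hFQ h) (fun h => hGR h)⟩)
    (fun F ⟨_, Q, hQ, hQf, hFQ⟩ hle => hfin Q hQ hQf
      (fun M hM => hFQ (le_trans hle hM : F ≤ M.1)))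
  have hb := ne_bot_of_le hIp hI
  obtain ⟨M, hM⟩ := exists_maxSpectrum_le hp.ne_one hb
  obtain ⟨V, hV, hMV⟩ := hcov (hIp.trans hM : I ≤ M.1)
  obtain ⟨F, hF, rfl⟩ := hP hV
  exact hS F ⟨hF, {zeroLocus F}, Set.singleton_subset_iff.2 hV, Set.finite_singleton _,
    by simp⟩ (le_trans hMV (max_le_of_isPrime hp hb hM))

end WeakIdealSystem

/-! ### Values as upper semicontinuous functions -/

namespace WeakIdealSystem

variable {H : Type u} [CommMonoid H] {r : WeakIdealSystem H} [hr : r.IsCancellativeSystem]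

/-- Every nontrivial maximal `r`-ideal contains a nontrivial radical compact `r`-ideal. -/
class HasCompactRadicals (r : WeakIdealSystem H) : Prop where
  exists_le : ∀ M : r.MaxSpectrum, ∃ J : r.RIdeal, IsCompactElement J ∧ J ≠ ⊥ ∧ J.IsRadical ∧
    J ≤ M.1

variable [hD : r.IsAlmostDedekind] {M : r.MaxSpectrum} {I J : r.RIdeal}

section

variable [hR : r.HasCompactRadicals]

/-- With `n = val M I`, the compact `J ^ n` lies in `I` locally at `M`, hence also at all `N` near
`M`. There the value of `I` is at most that of `J ^ n`, which is at most `n` as `J` is radical. -/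
theorem upperSemicontinuous_val (hI : I ≠ ⊥) : UpperSemicontinuous fun M => val M I := by
  intro M k hk
  obtain ⟨J, hJ, hJb, hJr, hJM⟩ := hR.exists_le M
  set n := val M I
  have h1 : ∀ N, val N (J ^ n) ≤ n := fun N => by
    rw [val_pow N hJb]
    exact (Nat.mul_le_mul_left n (val_le_one_of_isRadical hJb hJr)).trans (mul_one n).le
  have h2 : n ≤ val M (J ^ n) := by
    rw [val_pow M hJb]
    exact (mul_one n).ge.trans (Nat.mul_le_mul_left n ((one_le_val_iff hJb).2 hJM))
  obtain ⟨s, hs, hsJ⟩ := exists_mul_le_of_isCompactElement (isCompactElement_pow hJ n)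
    ((le_loc_iff_val (pow_ne_bot hJb n) hI).2 h2)
  have hnot : ¬ colon I (J ^ n).carrier ≤ M.1 := fun h =>
    hs (h (princ_le.1 (le_colon.2 hsJ)))
  obtain ⟨E, hEM, hE, hE1⟩ := exists_isCompactElement_sup_eq_one (sup_eq_one_of_not_le M hnot)
  refine Filter.mem_of_superset ((isOpen_zeroLocus hE).mem_nhds hEM) fun N hN => ?_
  have hN' : ¬ colon I (J ^ n).carrier ≤ N.1 := fun h => (maxSpectrum_isPrime N).ne_one
    ((le_one _).antisymm (hE1.ge.trans (sup_le hN h)))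
  obtain ⟨t, ht, htN⟩ := Set.not_subset.1 hN'
  have h3 : J ^ n ≤ loc N I := fun x hx => mem_loc.2 ⟨t, htN, ht x hx⟩
  exact (((le_loc_iff_val (pow_ne_bot hJb n) hI).1 h3).trans (h1 N)).trans_lt hk

omit hR in
theorem hasCompactSupport_val (hI : I ≠ ⊥) : HasCompactSupport fun M => val M I := by
  have h : Function.support (fun M => val M I) = zeroLocus I := by
    ext M
    rw [Function.mem_support, ← Nat.one_le_iff_ne_zero, one_le_val_iff hI]; rfl
  rw [HasCompactSupport, tsupport, h, (isClosed_zeroLocus I).closure_eq]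
  exact isCompact_zeroLocus hI

/-- The `r`-ideal of all elements whose values are bounded below by `f`. -/
noncomputable def ofFun (f : r.MaxSpectrum → ℕ) : r.RIdeal := ⨅ M, loc M (M.1 ^ f M)

/-- The values of `ofFun f` are at least `f`. For equality at `M`, a product `F * R ^ f M` below
`ofFun f` with value exactly `f M` at `M` is built: `R` has value one at `M` and `f ≤ f M` on its
zero locus, while `F`, not below `M`, dominates `f` on the rest of the support. -/
theorem ofFun_ne_bot_and_val_ofFun {f : r.MaxSpectrum → ℕ} (hf : UpperSemicontinuous f)
    (hc : HasCompactSupport f) : ofFun f ≠ ⊥ ∧ ∀ M, val M (ofFun f) = f M := by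
  have hloc : ∀ (G : r.RIdeal) (N : r.MaxSpectrum), G ≠ ⊥ → f N ≤ val N G →
      G ≤ loc N (N.1 ^ f N) := fun G N hG h => by
    rw [le_loc_iff_val hG (pow_ne_bot (maxSpectrum_ne_bot N) _), val_max_pow]
    exact h
  have key : ∀ M : r.MaxSpectrum, ∃ G ≠ ⊥, G ≤ ofFun f ∧ val M G = f M := by
    intro M
    obtain ⟨J, hJ, hJb, hJr, hJM⟩ := hR.exists_le M
    have hlocal : ∀ N : r.MaxSpectrum, ∃ E : r.RIdeal, IsCompactElement E ∧ E ≤ N.1 ∧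
        zeroLocus E ⊆ {L | f L ≤ f N} := fun N => by
      obtain ⟨U, hU, hUo, hNU⟩ := mem_nhds_iff.1 (hf N (f N + 1) (Nat.lt_succ_self _))
      obtain ⟨E, hE, hEN, hEU⟩ := exists_zeroLocus_subset hUo hNU
      exact ⟨E, hE, hEN, fun L hL => Nat.lt_succ_iff.1 (hU (hEU hL))⟩
    obtain ⟨E, hE, hEM, hEf⟩ := hlocal M
    set R := J ⊔ E
    have hRb : R ≠ ⊥ := ne_bot_of_le le_sup_left hJb
    have hRM : R ≤ M.1 := sup_le hJM hEM
    have hRo : IsOpen (zeroLocus R) := isOpen_zeroLocus (isCompactElement_sup hJ hE)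
    -- Near `N ∈ K` the factor `(E' ⊔ (x)) ^ f N` with `x ∈ N \ M` suffices; finitely many such
    -- factors are multiplied.
    have hF : ∀ K : Set r.MaxSpectrum, IsCompact K → M ∉ K → ∃ F : r.RIdeal, ¬ F ≤ M.1 ∧
        ∀ N ∈ K, f N ≤ val N F := by
      intro K hK hMK
      have hnb : ∀ F : r.RIdeal, ¬ F ≤ M.1 → F ≠ ⊥ := fun F hF hb => hF (hb ▸ bot_le)
      refine hK.induction_on (p := fun K => ∃ F : r.RIdeal, ¬ F ≤ M.1 ∧
        ∀ N ∈ K, f N ≤ val N F) ⟨1, fun h => (maxSpectrum_isPrime M).ne_one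
          ((le_one _).antisymm h), by simp⟩ (fun s t hst ⟨F, hF, h⟩ => ⟨F, hF, fun N hN =>
          h N (hst hN)⟩) ?_ ?_
      · rintro s t ⟨F, hF, hs⟩ ⟨G, hG, ht⟩
        refine ⟨F * G, fun h => ((maxSpectrum_isPrime M).le_or_le h).elim hF hG, ?_⟩
        intro N hN
        rw [val_mul N (hnb F hF) (hnb G hG)]
        rcases hN with hN | hN
        · exact (hs N hN).trans (Nat.le_add_right _ _)
        · exact (ht N hN).trans (Nat.le_add_left _ _)
      · intro N hN
        have hNM : ¬ N.1 ≤ M.1 := fun h => hMK (maxSpectrum_eq_of_le h ▸ hN)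
        obtain ⟨x, hxN, hxM⟩ := Set.not_subset.1 hNM
        obtain ⟨E', hE', hEN', hEf'⟩ := hlocal N
        have hA : ¬ E' ⊔ r.princ x ≤ M.1 := fun h => hxM (princ_le.1 (le_sup_right.trans h))
        refine ⟨zeroLocus (E' ⊔ r.princ x), mem_nhdsWithin_of_mem_nhds
          ((isOpen_zeroLocus (isCompactElement_sup hE' (isCompactElement_princ x))).mem_nhds
            (sup_le hEN' (princ_le.2 hxN))), (E' ⊔ r.princ x) ^ f N,
            fun h => hA ((maxSpectrum_isPrime M).le_of_pow_le h), fun L hL => ?_⟩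
        rw [val_pow L (hnb _ hA)]
        exact (hEf' (le_sup_left.trans hL : E' ≤ L.1)).trans
          ((mul_one _).ge.trans (Nat.mul_le_mul_left _ ((one_le_val_iff (hnb _ hA)).2 hL)))
    obtain ⟨F, hFM, hF⟩ := hF (tsupport f ∩ (zeroLocus R)ᶜ)
      (IsCompact.inter_right hc hRo.isClosed_compl) (fun h => h.2 hRM)
    have hFb : F ≠ ⊥ := fun hb => hFM (hb ▸ bot_le)
    have hval : ∀ N, val N (F * R ^ f M) = val N F + f M * val N R := fun N => by
      rw [val_mul N hFb (pow_ne_bot hRb _), val_pow N hRb]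
    refine ⟨F * R ^ f M, mul_ne_bot hFb (pow_ne_bot hRb _), le_iInf fun N => hloc _ N
      (mul_ne_bot hFb (pow_ne_bot hRb _)) ?_, ?_⟩
    · rw [hval]
      by_cases hN : N ∈ zeroLocus R
      · exact (hEf (le_sup_right.trans hN : E ≤ N.1)).trans (((mul_one _).ge.trans
          (Nat.mul_le_mul_left _ ((one_le_val_iff hRb).2 hN))).trans (Nat.le_add_left _ _))
      · by_cases hN' : N ∈ tsupport f
        · exact (hF N ⟨hN', hN⟩).trans (Nat.le_add_right _ _)
        · rw [image_eq_zero_of_notMem_tsupport hN']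
          exact Nat.zero_le _
    · have h1 : val M R = 1 := le_antisymm
        ((val_anti hJb le_sup_left).trans (val_le_one_of_isRadical hJb hJr))
        ((one_le_val_iff hRb).2 hRM)
      have h2 : val M F = 0 := by
        by_contra h0
        exact hFM ((one_le_val_iff hFb).1 (Nat.one_le_iff_ne_zero.2 h0))
      rw [hval, h1, h2, zero_add, mul_one]
  by_cases hX : Nonempty r.MaxSpectrum
  · have hb : ofFun f ≠ ⊥ := by
      obtain ⟨M⟩ := hX
      obtain ⟨G, hG, hGf, -⟩ := key M
      exact ne_bot_of_le hGf hG
    refine ⟨hb, fun M => ?_⟩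
    obtain ⟨G, hG, hGf, hGM⟩ := key M
    refine le_antisymm ((val_anti hG hGf).trans hGM.le) ?_
    have := (le_loc_iff_val (M := M) hb (pow_ne_bot (maxSpectrum_ne_bot M) (f M))).1 (iInf_le _ M)
    rwa [val_max_pow] at this
  -- Without nontrivial maximal `r`-ideals the infimum is empty and equals `1`.
  · rw [not_nonempty_iff] at hX
    refine ⟨?_, hX.elim⟩
    rw [ofFun, iInf_of_empty, ← one_eq_top]
    exact one_ne_bot

theorem exists_val_eq {f : r.MaxSpectrum → ℕ} (hf : UpperSemicontinuous f)
    (hc : HasCompactSupport f) : ∃ I : r.RIdeal, I ≠ ⊥ ∧ ∀ M, val M I = f M :=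
  ⟨_, ofFun_ne_bot_and_val_ofFun hf hc⟩

/-- The function of all values of a nontrivial `r`-ideal. -/
noncomputable def valFun (I : r.RIdeal) (hI : I ≠ ⊥) : USCFun r.MaxSpectrum :=
  ⟨fun M => val M I, upperSemicontinuous_val hI, hasCompactSupport_val hI⟩

open Classical in
/-- The map that sends an `r`-ideal to the function of its values, and the trivial one to `b`. -/
noncomputable def toUBot (I : r.RIdeal) : UBot r.MaxSpectrum :=
  if hI : I = ⊥ then 0 else (valFun I hI : USCFun r.MaxSpectrum)

theorem toUBot_bot : toUBot (⊥ : r.RIdeal) = 0 := dif_pos rfl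

theorem toUBot_of_ne_bot (hI : I ≠ ⊥) : toUBot I = (valFun I hI : USCFun r.MaxSpectrum) :=
  dif_neg hI

theorem toUBot_le_iff : toUBot I ≤ toUBot J ↔ I ≤ J := by
  by_cases hI : I = ⊥
  · subst hI
    simp [toUBot_bot]
  by_cases hJ : J = ⊥
  · subst hJ
    rw [toUBot_of_ne_bot hI, toUBot_bot]
    simp [hI]
  · rw [toUBot_of_ne_bot hI, toUBot_of_ne_bot hJ, WithZero.coe_le_coe, le_iff_val hI hJ]
    rfl

theorem toUBot_mul : toUBot (I * J) = toUBot I * toUBot J := by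
  by_cases hI : I = ⊥
  · subst hI
    rw [bot_mul', toUBot_bot, zero_mul]
  by_cases hJ : J = ⊥
  · subst hJ
    rw [mul_comm, bot_mul', toUBot_bot, mul_zero]
  · rw [toUBot_of_ne_bot hI, toUBot_of_ne_bot hJ, toUBot_of_ne_bot (mul_ne_bot hI hJ),
      ← WithZero.coe_mul]
    congr 1
    exact Subtype.ext (funext fun M => val_mul M hI hJ)

theorem toUBot_surjective : Function.Surjective (toUBot : r.RIdeal → UBot r.MaxSpectrum) := by
  intro f
  induction f using WithZero.recZeroCoe with
  | zero => exact ⟨⊥, toUBot_bot⟩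
  | coe f =>
    obtain ⟨I, hI, h⟩ := exists_val_eq f.2.1 f.2.2
    refine ⟨I, (toUBot_of_ne_bot hI).trans ?_⟩
    congr 1
    exact Subtype.ext (funext h)

theorem nonempty_orderMonoidIso (r : WeakIdealSystem H) [r.IsCancellativeSystem]
    [r.IsAlmostDedekind] [r.HasCompactRadicals] :
    Nonempty (r.RIdeal ≃*o UBot r.MaxSpectrum) :=
  ⟨{ MulEquiv.ofBijective (MulHom.mk toUBot fun _ _ => toUBot_mul)
      ⟨fun _ _ h => le_antisymm (toUBot_le_iff.1 h.le) (toUBot_le_iff.1 h.ge),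
        toUBot_surjective⟩ with
    map_le_map_iff' := toUBot_le_iff }⟩

/-- The values of `rad E` form the indicator of `zeroLocus E`, which is open and closed. For nonzero
`x ∈ E`, subtracting it from the values of `x` therefore stays upper semicontinuous, and an
`r`-ideal `J` with these values satisfies `rad E * J = (x)`. -/
theorem isInvertible_rad {E : r.RIdeal} (hE : IsCompactElement E) (hb : E ≠ ⊥) :
    r.IsInvertible (rad E).carrier := by
  classical
  obtain ⟨x, hxE, hx0⟩ := ne_bot_iff.1 hb
  have hxb := princ_ne_bot (r := r) hx0
  have hRb := ne_bot_of_le (le_rad E) hb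
  have hR : ∀ M, val M (rad E) = if M ∈ zeroLocus E then 1 else 0 := fun M => by
    have h1 : val M (rad E) ≤ 1 := val_le_one_of_isRadical hRb (isRadical_rad E)
    have h2 : 1 ≤ val M (rad E) ↔ M ∈ zeroLocus E := by
      rw [one_le_val_iff hRb]
      exact ⟨(le_rad E).trans, rad_le (maxSpectrum_isPrime M).isRadical⟩
    split_ifs with h
    · exact h1.antisymm (h2.2 h)
    · by_contra h0
      exact h (h2.1 (Nat.one_le_iff_ne_zero.2 h0))
  have hx : ∀ M ∈ zeroLocus E, 1 ≤ val M (r.princ x) := fun M hM =>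
    (one_le_val_iff hxb).2 ((princ_le.2 hxE).trans hM)
  have husc := upperSemicontinuous_val hxb
  obtain ⟨J, hJb, hJ⟩ := exists_val_eq (r := r) (f := fun M => val M (r.princ x) - val M (rad E))
    (fun M k hk => by
      by_cases hM : M ∈ zeroLocus E
      · filter_upwards [(isOpen_zeroLocus hE).mem_nhds hM, husc M (k + 1) (by
          have := hx M hM
          simp only [hR, if_pos hM] at hk
          change val M (r.princ x) < k + 1
          omega)] with N hN hN'
        have := hx N hN
        simp only [hR, if_pos hN]
        omega
      · filter_upwards [(isClosed_zeroLocus E).isOpen_compl.mem_nhds hM, husc M k (by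
          simpa only [hR, if_neg hM, Nat.sub_zero] using hk)] with N hN hN'
        simpa only [hR, if_neg hN, Nat.sub_zero] using hN')
    ((hasCompactSupport_val hxb).mono' fun M hM => subset_tsupport _ fun h => hM (by
      change val M (r.princ x) - _ = 0
      rw [show val M (r.princ x) = 0 from h, Nat.zero_sub]))
  refine isInvertible_iff.2 ⟨J, x, hx0, eq_of_val_eq (mul_ne_bot hRb hJb) hxb fun M => ?_⟩
  rw [val_mul M hRb hJb, hJ, hR]
  split_ifs with h
  · have := hx M h
    omega
  · omega

end

end WeakIdealSystem

namespace WeakIdealSystem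

variable {H : Type u} [CommMonoid H] {r : WeakIdealSystem H} [hr : r.IsCancellativeSystem]

/-! ### Local structure of SP-monoids -/

section Modular

variable [IsModularLattice r.RIdeal] {M : r.MaxSpectrum} {A B C K : r.RIdeal}

/-- Cancellation of `w` modulo `C`. By the modular law `(w A ⊔ C) ⊓ (w)` is `w A ⊔ (C ⊓ (w))`, and
both parts consist of multiples of `w`. -/
theorem mem_sup_colon_of_mul_mem {w z : H} (hw : w ∉ zeroElements H)
    (h : w * z ∈ r.princ w * A ⊔ C) : z ∈ A ⊔ colon C {w} := by
  have h1 : w * z ∈ (r.princ w * A ⊔ C) ⊓ r.princ w :=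
    mem_inf.2 ⟨h, mul_mem_right (mem_princ_self w) z⟩
  have h2 : r.princ w * A ⊔ C ⊓ r.princ w ≤ r.princ w * (A ⊔ colon C {w}) := by
    refine sup_le (mul_le_mul_right le_sup_left _) fun y hy => ?_
    obtain ⟨hyC, hyw⟩ := mem_inf.1 hy
    obtain ⟨t, rfl⟩ := mem_princ.1 hyw
    exact mul_mem_mul (mem_princ_self w) ((le_sup_right : _ ≤ A ⊔ colon C {w})
      (mem_colon_singleton.2 (mul_comm w t ▸ hyC)))
  exact (mul_mem_princ_mul hw).1 (h2 (sup_inf_le_assoc_of_le C (mul_le_left _ A) h1))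

/-- An `r`-ideal that is principal and regular modulo `C` is locally generated modulo `C` by a
product of elements of the factors of any factorization. -/
theorem exists_mem_loc_sup_princ {u : H} (hu : u ∉ zeroElements H) (hC : colon C {u} ≤ M.1)
    (hT : A * B = r.princ u ⊔ C) : ∃ a ∈ A, ∃ b ∈ B, u ∈ loc M (C ⊔ r.princ (a * b)) := by
  -- Otherwise cancelling `u` modulo `C` would give `1 ∈ M ⊔ colon C {u} ≤ M`.
  have hne : ¬ A * B ≤ r.princ u * M.1 ⊔ C := fun hle => by
    have h1 : u * 1 ∈ r.princ u * M.1 ⊔ C := by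
      rw [mul_one]
      exact hle (hT ▸ (le_sup_left : _ ≤ r.princ u ⊔ C) (mem_princ_self u))
    exact one_notMem_max M (sup_le le_rfl hC (mem_sup_colon_of_mul_mem hu h1))
  rw [mul_le] at hne
  push Not at hne
  obtain ⟨a, ha, b, hb, hab⟩ := hne
  refine ⟨a, ha, b, hb, ?_⟩
  set N := r.princ u * M.1 ⊔ (C ⊔ r.princ (a * b))
  have habT : a * b ∈ r.princ u ⊔ C := hT ▸ mul_mem_mul ha hb
  have hMQ : M.1 ≤ colon N {u} := fun m hm => mem_colon_singleton.2 <|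
    (le_sup_left : _ ≤ N) (mul_comm u m ▸ mul_mem_mul (mem_princ_self u) hm)
  -- By maximality `colon N {u}` is `M` or `1`. In the first case the modular law would put `a * b`
  -- into `u M ⊔ C`.
  have huN : u ∈ N := by
    by_contra huN
    have hQM : colon N {u} ≤ M.1 := by
      by_contra h
      have h1 := sup_eq_one_of_not_le M h
      rw [sup_eq_right.2 hMQ, eq_one_iff, mem_colon_singleton, one_mul] at h1
      exact huN h1
    refine hab ?_
    have habN : a * b ∈ (C ⊔ r.princ u) ⊓ N := mem_inf.2 ⟨sup_comm C (r.princ u) ▸ habT,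
      (le_sup_right.trans le_sup_right : r.princ (a * b) ≤ N) (mem_princ_self _)⟩
    have h2 := sup_inf_le_assoc_of_le (r.princ u) (le_sup_left.trans le_sup_right : C ≤ N) habN
    refine (sup_le le_sup_right fun y hy => ?_ : C ⊔ r.princ u ⊓ N ≤ _) h2
    obtain ⟨hyu, hyN⟩ := mem_inf.1 hy
    obtain ⟨t, rfl⟩ := mem_princ.1 hyu
    exact (le_sup_left : _ ≤ r.princ u * M.1 ⊔ C) (mul_mem_mul (mem_princ_self u)
      (hQM (mem_colon_singleton.2 (mul_comm u t ▸ hyN))))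
  -- As in Nakayama's lemma, the summand `u M` is removed by cancelling `u`: the residual of `C ⊔ (a
  -- * b)` by `u` cannot lie in `M`.
  have h1 := mem_sup_colon_of_mul_mem (r := r) (A := M.1)
    (C := C ⊔ r.princ (a * b)) (z := 1) hu (by rw [mul_one]; exact huN)
  have hnot : ¬ colon (C ⊔ r.princ (a * b)) {u} ≤ M.1 := fun h =>
    one_notMem_max M (sup_le le_rfl h h1)
  obtain ⟨s, hs, hsM⟩ := Set.not_subset.1 hnot
  exact mem_loc.2 ⟨s, hsM, mem_colon_singleton.1 hs⟩

/-- Choose `a`, `b` with `u` locally in `C ⊔ (a * b)`; both are regular modulo `C`. Cancelling `b`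
puts `A` locally into `C ⊔ (a)`, so `C ≤ A * B` is locally in `C B ⊔ a B`. Within `C`, the modular
law leaves only `a B ∩ C ≤ a C` of the second part. -/
theorem le_loc_mul_sup {u : H} (hu : u ∉ zeroElements H) (hCM : C ≤ M.1) (hC : loc M C ≤ C)
    (hCu : colon C {u} ≤ C) (hT : A * B = r.princ u ⊔ C) : C ≤ loc M (C * (A ⊔ B)) := by
  obtain ⟨a, ha, b, hb, hab⟩ := exists_mem_loc_sup_princ hu (hCu.trans hCM) hT
  obtain ⟨s, hs, hsu⟩ := mem_loc.1 hab
  have hreg : ∀ t, a * b * t ∈ C → t ∈ C := fun t ht => by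
    have hle : C ⊔ r.princ (a * b) ≤ colon C {t} :=
      sup_le (le_colon_self C _) (princ_le.2 (mem_colon_singleton.2 ht))
    have h1 : s * (u * t) ∈ C := by
      rw [← mul_assoc]
      exact mem_colon_singleton.1 (hle hsu)
    exact hCu (mem_colon_singleton.2 (mul_comm u t ▸ hC (mem_loc.2 ⟨s, hs, h1⟩)))
  have hrega : ∀ t, a * t ∈ C → t ∈ C := fun t ht => hreg t <| by
    rw [mul_right_comm]; exact mul_mem_right ht b
  have hregb : ∀ t, b * t ∈ C → t ∈ C := fun t ht => hreg t <| by
    rw [mul_assoc]; exact mul_mem_left a ht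
  have hb0 : b ∉ zeroElements H := fun hb0 => one_notMem_max M <| hCM <| hregb 1 <|
    mul_mem_right (mem_of_mem_zeroElements hb0) 1
  have hTs : r.princ u ⊔ C ≤ colon (C ⊔ r.princ (a * b)) {s} :=
    sup_le (princ_le.2 (mem_colon_singleton.2 (mul_comm s u ▸ hsu)))
      (le_sup_left.trans (le_colon_self _ _))
  have hA : A ≤ loc M (C ⊔ r.princ a) := fun z hz => by
    refine mem_loc.2 ⟨s, hs, ?_⟩
    have h1 : z * b * s ∈ C ⊔ r.princ (a * b) :=
      mem_colon_singleton.1 (hTs (hT ▸ mul_mem_mul hz hb))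
    have h2 : b * (s * z) ∈ r.princ b * r.princ a ⊔ C := by
      rw [← princ_mul, mul_comm b a, sup_comm, show b * (s * z) = z * b * s by
        rw [mul_comm s z, ← mul_assoc, mul_comm b z]]
      exact h1
    have h3 := mem_sup_colon_of_mul_mem hb0 h2
    rw [sup_comm] at h3
    have hCb : colon C {b} ≤ C := fun t ht => hregb t (mul_comm t b ▸ mem_colon_singleton.1 ht)
    exact (sup_le_sup_right hCb (r.princ a) :) h3
  have hCT : C ≤ loc M ((C ⊔ r.princ a) * B) :=
    (le_sup_right.trans hT.ge).trans (mul_le_loc_left B hA)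
  intro c hc
  obtain ⟨t, ht, htc⟩ := mem_loc.1 (hCT hc)
  refine mem_loc.2 ⟨t, ht, ?_⟩
  rw [sup_mul] at htc
  have h1 : t * c ∈ (C * B ⊔ r.princ a * B) ⊓ C := mem_inf.2 ⟨htc, mul_mem_left t hc⟩
  have h2 := sup_inf_le_assoc_of_le (r.princ a * B) (mul_le_left C B) h1
  refine (sup_le (mul_le_mul_right le_sup_right C) fun y hy => ?_ :
    C * B ⊔ r.princ a * B ⊓ C ≤ C * (A ⊔ B)) h2
  obtain ⟨hya, hyC⟩ := mem_inf.1 hy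
  obtain ⟨i, -, rfl⟩ := mem_princ_mul.1 hya
  rw [mul_comm a]
  exact mul_mem_mul (hrega i hyC) ((le_sup_left : A ≤ A ⊔ B) ha)

omit hr [IsModularLattice r.RIdeal] in
theorem prod_map_sup_le (l : List r.RIdeal) (K : r.RIdeal) :
    (l.map (· ⊔ K)).prod ≤ K ⊔ l.prod := by
  induction l with
  | nil => simp
  | cons A l ih =>
    rw [List.map_cons, List.prod_cons, List.prod_cons]
    refine (mul_le_mul_right ih _).trans ?_
    rw [sup_mul, mul_sup]
    exact sup_le (sup_le ((mul_le_right _ _).trans le_sup_left) le_sup_right)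
      ((mul_le_left _ _).trans le_sup_left)

omit [IsModularLattice r.RIdeal] in
theorem le_loc_mul_prod {l : List r.RIdeal} (h : ∀ A ∈ l, C ≤ loc M (C * A)) :
    C ≤ loc M (C * l.prod) := by
  induction l with
  | nil => simpa using le_loc M C
  | cons A l ih =>
    rw [List.prod_cons, ← mul_assoc]
    exact le_loc_trans (ih fun B hB => h B (by simp [hB]))
      (mul_le_loc_left l.prod (h A (by simp)))

/-- In an SP-monoid the nonunits of a localization are divisible by all nonzero radical
elements. -/
theorem IsSPMonoid.mem_loc_princ (hSP : r.IsSPMonoid) {y : H} (hy0 : y ∉ zeroElements H)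
    (hy : (loc M (r.princ y)).IsRadical) {w : H} (hw : w ∈ M.1) : w ∈ loc M (r.princ y) := by
  by_contra hwy
  have hw0 : w ∉ zeroElements H := nonzero_of_notMem hwy
  have hu0 := pow_nonzero r hw0 2
  -- `C` is stable under localization and contained in `M`; radicality of the localization of `(y)`
  -- makes `w` regular modulo `C`.
  set C := colon (loc M (r.princ y)) {w} with hCdef
  have hC : loc M C ≤ C := fun z hz => by
    obtain ⟨s, hs, hz⟩ := mem_loc.1 hz
    refine mem_colon_singleton.2 (mem_loc_of_mul_mem hs ?_)
    rw [← mul_assoc]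
    exact mem_colon_singleton.1 hz
  have hCM : C ≤ M.1 := by
    by_contra h
    obtain ⟨s, hs, hsM⟩ := Set.not_subset.1 h
    exact hwy (mem_loc_of_mul_mem hsM (mem_colon_singleton.1 hs))
  have hCw : colon C {w} ≤ C := fun z hz => by
    have h1 : z * w * w ∈ loc M (r.princ y) :=
      mem_colon_singleton.1 (mem_colon_singleton.1 hz)
    refine mem_colon_singleton.2 (hy.mem_of_pow_mem (n := 2) ?_)
    rw [show (z * w) ^ 2 = z * w * w * z by rw [sq, mul_assoc (z * w), mul_comm w z]]
    exact mul_mem_right h1 z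
  have hCu : colon C {w ^ 2} ≤ C := fun z hz => hCw <| mem_colon_singleton.2 <| hCw <|
    mem_colon_singleton.2 <| by
      rw [mul_assoc, ← sq]; exact mem_colon_singleton.1 hz
  set K := r.princ w ⊔ C
  have hwK : w ∈ K := (le_sup_left : _ ≤ K) (mem_princ_self w)
  have hKM : K ≤ M.1 := sup_le (princ_le.2 hw) hCM
  set T := r.princ (w ^ 2) ⊔ C
  have hwT : w * w ∈ T := sq w ▸ (le_sup_left : _ ≤ T) (mem_princ_self _)
  have hTeq : T = r.princ w * r.princ w ⊔ C := by rw [← princ_mul, ← sq]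
  have hTK : ∀ b, w * b ∈ T → b ∈ K := fun b hb =>
    sup_le_sup_left hCw _ (mem_sup_colon_of_mul_mem hw0 (hTeq ▸ hb))
  have hTleK : T ≤ K := sup_le (princ_le.2 (sq w ▸ mul_mem_right hwK w)) le_sup_right
  obtain ⟨l, hl, hlT⟩ := hSP T
  -- A radical factor `A` of `T` contains `w` because `w ^ 2 ∈ T`. So its cofactor `B` satisfies `w
  -- B ≤ T`, and cancelling `w` modulo `C` gives `B ≤ K`.
  have h1 : ∀ A ∈ l, C ≤ loc M (C * (A ⊔ K)) := fun A hA => by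
    obtain ⟨B, hB⟩ := exists_mul_eq_prod hA
    rw [← hlT] at hB
    have hwA : w ∈ A := (hl A hA).mem_of_pow_mem (n := 2) (mul_le_left A B (hB ▸ sq w ▸ hwT))
    have hBK : B ≤ K := fun b hb => hTK b (hB ▸ mul_mem_mul hwA hb)
    exact (le_loc_mul_sup hu0 hCM hC hCu hB).trans
      (loc_mono (mul_le_mul_right (sup_le_sup_left hBK A) C))
  -- The product of all `A ⊔ K` lies in `K ⊔ T = K`.
  have h2 : C ≤ loc M (C * K) := by
    have := le_loc_mul_prod (M := M) (l := l.map (· ⊔ K)) (C := C) (by simpa using h1)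
    refine this.trans (loc_mono (mul_le_mul_right ((prod_map_sup_le l K).trans ?_) C))
    exact sup_le le_rfl (hlT ▸ hTleK)
  have h3 : C ≤ loc M (C * (K * K)) := by
    rw [← mul_assoc]
    exact le_loc_trans h2 (mul_le_loc_left K h2)
  have hyC : y ∈ C := mem_colon_singleton.2 (le_loc M _ (mul_mem_right (mem_princ_self y) w))
  have hwC : r.princ w * C ≤ loc M (r.princ y) := mul_le.2 fun x hx c hc => by
    obtain ⟨t, rfl⟩ := mem_princ.1 hx
    rw [mul_right_comm]
    exact mul_mem_right (mul_comm c w ▸ mem_colon_singleton.1 hc) t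
  -- Since `y ∈ C` and `w C` is locally in `(y)`, cancelling `y` below gives `s * w ∈ K * K ≤ T`
  -- with `s ∉ M`; cancelling `w` modulo `C` then puts `s` into `K ≤ M`.
  have h4 : w * y ∈ loc M (r.princ y * (K * K)) := by
    have h5 : r.princ w * C ≤ loc M (r.princ w * (C * (K * K))) :=
      mul_le_loc (le_loc M _) h3
    refine le_loc_trans h5 ?_ (mul_mem_mul (mem_princ_self w) hyC)
    rw [← mul_assoc]
    exact mul_le_loc_left _ hwC
  obtain ⟨s, hs, hsy⟩ := mem_loc.1 h4
  have h6 : s * w ∈ K * K := by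
    rw [show s * (w * y) = y * (s * w) by rw [← mul_assoc, mul_comm]] at hsy
    exact (mul_mem_princ_mul hy0).1 hsy
  have hKK : K * K ≤ T := by
    rw [hTeq]
    rw [sup_mul, mul_sup]
    exact sup_le (sup_le le_sup_left ((mul_le_right _ _).trans le_sup_right))
      ((mul_le_left _ _).trans le_sup_right)
  exact hs (hKM (hTK s (mul_comm s w ▸ hKK h6)))

end Modular

theorem hasCompactRadicals_of_forall_exists_isInvertible
    (h : ∀ M : r.MaxSpectrum, ∃ J : r.RIdeal, J ≤ M.1 ∧ r.IsInvertible J.carrier ∧ J.IsRadical) :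
    r.HasCompactRadicals :=
  ⟨fun M => by
    obtain ⟨J, hJM, hJ, hJr⟩ := h M
    exact ⟨J, isCompactElement_of_isInvertible hJ, isInvertible_ne_bot hJ, hJr, hJM⟩⟩

theorem isRadical_loc_princ {M : r.MaxSpectrum} {J : r.RIdeal} {p : H} (hJ : J.IsRadical)
    (hp : p ∈ J) (hJp : J ≤ loc M (r.princ p)) : (loc M (r.princ p)).IsRadical := by
  have : loc M (r.princ p) = loc M J :=
    le_antisymm (loc_mono (princ_le.2 hp)) (loc_le_loc_iff.2 hJp)
  rw [this]
  exact isRadical_loc hJ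

/-- Factor a nonzero principal `r`-ideal inside `P`: its factors are invertible, and `P` contains
one of them. -/
theorem exists_isInvertible_isRadical_le (hSP : ∀ I : r.RIdeal,
      r.IsInvertible I.carrier → ∃ l : List r.RIdeal, (∀ J ∈ l, J.IsRadical) ∧ I = l.prod)
    {P : r.RIdeal} (hP : P.IsPrime) (hb : P ≠ ⊥) :
    ∃ J : r.RIdeal, J ≤ P ∧ r.IsInvertible J.carrier ∧ J.IsRadical := by
  obtain ⟨x, hx, hx0⟩ := ne_bot_iff.1 hb
  obtain ⟨l, hl, hlx⟩ := hSP _ (isInvertible_princ (r := r) hx0)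
  obtain ⟨J, hJ, hJP⟩ := hP.exists_le_of_prod_le (hlx ▸ princ_le.2 hx)
  exact ⟨J, hJP, isInvertible_of_mem_of_prod (hlx ▸ isInvertible_princ hx0) hJ, hl J hJ⟩

theorem IsSPMonoid.hasCompactRadicals (hSP : r.IsSPMonoid) : r.HasCompactRadicals :=
  hasCompactRadicals_of_forall_exists_isInvertible fun M =>
    exists_isInvertible_isRadical_le (fun I _ => hSP I) (maxSpectrum_isPrime M)
      (maxSpectrum_ne_bot M)

theorem IsSPMonoid.isAlmostDedekind [IsModularLattice r.RIdeal] (hSP : r.IsSPMonoid) :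
    r.IsAlmostDedekind := ⟨fun M => by
  obtain ⟨J, hJM, hJ, hJr⟩ := exists_isInvertible_isRadical_le (fun I _ => hSP I)
    (maxSpectrum_isPrime M) (maxSpectrum_ne_bot M)
  obtain ⟨p, hp, hp0, hJp⟩ := exists_le_loc_princ M hJ
  have hMp : M.1 ≤ loc M (r.princ p) := fun w hw =>
    hSP.mem_loc_princ hp0 (isRadical_loc_princ hJr hp hJp) hw
  refine isDiscreteAt_of_pow_mem (hJM hp) hMp fun x hx0 => ?_
  obtain ⟨l, hl, hlx⟩ := hSP (r.princ x)
  refine ⟨l.length, ?_⟩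
  -- A factor of `(x)` below `M` is locally generated by some `a` with radical localization, which
  -- therefore divides `p` locally.
  have key : ∀ A ∈ l, r.princ p ≤ loc M A := fun A hA => by
    by_cases hAM : A ≤ M.1
    · obtain ⟨a, ha, ha0, hAa⟩ := exists_le_loc_princ M
        (isInvertible_of_mem_of_prod (hlx ▸ isInvertible_princ hx0) hA)
      exact princ_le.2 (loc_mono (princ_le.2 ha)
        (hSP.mem_loc_princ ha0 (isRadical_loc_princ (hl A hA) ha hAa) (hJM hp)))
    · rw [loc_eq_one hAM]; exact le_one _
  have hprod : ∀ l : List r.RIdeal, (∀ A ∈ l, r.princ p ≤ loc M A) →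
      r.princ p ^ l.length ≤ loc M l.prod := by
    intro l
    induction l with
    | nil => intro _; simpa using le_loc M 1
    | cons A l ih =>
      intro h
      rw [List.length_cons, pow_succ', List.prod_cons]
      exact mul_le_loc (h A (by simp)) (ih fun B hB => h B (by simp [hB]))
  rw [hlx, ← princ_le, princ_pow]
  exact hprod l key⟩

/-! ### Monoids of dimension one -/

theorem isAlmostDedekind_of_dim_le_one (hdim : r.dim ≤ 1) (h : ∀ M : r.MaxSpectrum,
    ∃ J : r.RIdeal, J ≤ M.1 ∧ r.IsInvertible J.carrier ∧ J.IsRadical) : r.IsAlmostDedekind :=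
  ⟨fun M => by
  have hmax : ∀ P : r.RIdeal, P.IsPrime → P ≤ M.1 → P ≠ ⊥ → M.1 ≤ P := fun P hP hPM hb => by
    rcases Order.krullDim_le_one_iff.1 hdim ⟨P, isLPrime_iff_isPrime.2 hP⟩ with h | h
    · have : P ≤ ⊥ := @h ⟨⊥, isLPrime_iff_isPrime.2 isPrime_bot⟩ (bot_le : ⊥ ≤ P)
      exact absurd (le_bot_iff.1 this) hb
    · exact @h ⟨M.1, isLPrime_iff_isPrime.2 (maxSpectrum_isPrime M)⟩ hPM
  obtain ⟨J, hJM, hJ, hJr⟩ := h M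
  obtain ⟨p, hp, hp0, hJp⟩ := exists_le_loc_princ M hJ
  have hMp : M.1 ≤ loc M (r.princ p) := by
    refine le_trans (fun x hx => by_contra fun hxJ => ?_) (loc_le_loc_iff.2 hJp)
    -- Avoiding all `s * x ^ n` with `s ∉ M` forces `P ≤ M` and `x ∉ P`; but `P` contains `J ≠ ⊥`,
    -- so `M ≤ P`.
    obtain ⟨P, hP, hJP, hSP⟩ := exists_isPrime_of_disjoint (I := J)
      (S := {z | ∃ s ∉ M.1, ∃ n : ℕ, z = s * x ^ n}) ⟨1, one_notMem_max M, 0, by simp⟩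
      (by
        rintro _ ⟨s, hs, m, rfl⟩ _ ⟨t, ht, n, rfl⟩
        exact ⟨s * t, mul_notMem_max M hs ht, m + n, by rw [pow_add, mul_mul_mul_comm]⟩)
      (by
        rintro _ ⟨s, hs, n, rfl⟩ hJ
        exact hxJ ((isRadical_loc hJr).mem_of_pow_mem (n := n) (mem_loc.2 ⟨s, hs, hJ⟩)))
    have hPM : P ≤ M.1 := fun z hz => by_contra fun hzM => hSP z ⟨z, hzM, 0, by simp⟩ hz
    exact hSP x ⟨1, one_notMem_max M, 1, by simp⟩ (hmax P hP hPM
      (ne_bot_of_mem (hJP hp) hp0) hx)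
  refine isDiscreteAt_of_le_loc_princ (hJM hp) hMp ?_
  by_contra! hex
  obtain ⟨x, hx0, hx⟩ := hex
  -- The infinitely divisible elements form a prime below `M`. If it were nontrivial it would
  -- contain `p`, making `p` locally divisible by `p ^ 2`.
  set Q : r.RIdeal := ⨅ n : ℕ, loc M (r.princ (p ^ n))
  have hQ : Q.IsPrime := by
    refine ⟨isProper_iff.2 fun h1 => ?_, fun a b hab => ?_⟩
    · have := mem_iInf.1 (eq_one_iff.1 h1) 1
      rw [pow_one] at this
      exact one_notMem_max M (loc_le_max (princ_le.2 (hJM hp)) this)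
    · by_contra! hc
      have key : ∀ z, z ∉ Q.carrier → ∃ n : ℕ, ∃ s ∉ M.1, ∃ t ∉ M.1, s * z = p ^ n * t := fun z hz =>
        exists_mul_eq_pow_mul hMp (not_forall.1 fun h => hz (mem_iInf.2 h))
      obtain ⟨m, s, hs, t, ht, hst⟩ := key a hc.1
      obtain ⟨n, s', hs', t', ht', hst'⟩ := key b hc.2
      refine pow_notMem_loc_princ_pow_succ (hJM hp) hp0 (m + n) (mem_loc_of_mul_mem
        (mul_notMem_max M ht ht') ?_)
      have e : t * t' * p ^ (m + n) = s * s' * (a * b) := by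
        rw [mul_mul_mul_comm s, hst, hst', mul_mul_mul_comm, pow_add, mul_comm]
      rw [e]
      exact mul_mem_left _ (mem_iInf.1 hab _)
  have hQM : Q ≤ M.1 := (iInf_le _ 1).trans <| by
    rw [pow_one]; exact loc_le_max (princ_le.2 (hJM hp))
  have hpQ : p ∈ Q := hmax Q hQ hQM (ne_bot_of_mem (mem_iInf.2 hx) hx0) (hJM hp)
  refine pow_notMem_loc_princ_pow_succ (M := M) (hJM hp) hp0 1 ?_
  rw [pow_one]
  exact mem_iInf.1 hpQ _⟩

/-! ### Invertible radicals -/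

section Radicals

variable (h : ∀ I : r.RIdeal, I ≠ ⊥ → IsCompactElement I → r.IsInvertible (rad I).carrier)
include h

/-- The radical of `(u) ⊔ (v)` is invertible; `w` is a local generator. -/
theorem exists_common_divisor (M : r.MaxSpectrum) {u v : H} (hu : u ∉ zeroElements H) :
    ∃ w, w ∉ zeroElements H ∧ u ∈ loc M (r.princ w) ∧ v ∈ loc M (r.princ w) ∧
      (∃ n : ℕ, 1 ≤ n ∧ w ^ n ∈ r.princ u ⊔ r.princ v) := by
  have hu' : u ∈ r.princ u ⊔ r.princ v :=
    (le_sup_left : _ ≤ r.princ u ⊔ r.princ v) (mem_princ_self u)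
  have hv' : v ∈ r.princ u ⊔ r.princ v :=
    (le_sup_right : _ ≤ r.princ u ⊔ r.princ v) (mem_princ_self v)
  obtain ⟨w, hw, hw0, hle⟩ := exists_le_loc_princ M (h (r.princ u ⊔ r.princ v)
    (ne_bot_of_mem hu' hu) (isCompactElement_sup (isCompactElement_princ u)
      (isCompactElement_princ v)))
  exact ⟨w, hw0, hle (le_rad _ hu'), hle (le_rad _ hv'), hw⟩

/-- Write `y = x b` locally and let `w` be a common divisor of `x` and `b`. Then `w ^ 2` divides
`y`, and as `y` is locally radical, `w` is a local unit. A power of `w` lies in `(x) ⊔ (b)` and `x ∈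
M`, so `b` is a unit too. -/
theorem mem_loc_princ_of_mem_loc_princ {M : r.MaxSpectrum} {x y : H} (hx : x ∈ M.1)
    (hy0 : y ∉ zeroElements H) (hy : (loc M (r.princ y)).IsRadical)
    (hyx : y ∈ loc M (r.princ x)) : x ∈ loc M (r.princ y) := by
  obtain ⟨s, hs, hsy⟩ := mem_loc.1 hyx
  obtain ⟨b, hb⟩ := mem_princ.1 hsy
  have hx0 : x ∉ zeroElements H := fun hx0 => by
    have h1 : s * y ∈ (⊥ : r.RIdeal) := hb ▸ mul_mem_right (mem_of_mem_zeroElements hx0) b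
    exact (mem_zeroElements_or r (mem_bot.1 h1)).elim (nonzero_of_notMem hs) hy0
  obtain ⟨w, hw0, hxw, hbw, n, hn, hwn⟩ := exists_common_divisor h M (v := b) hx0
  obtain ⟨t, ht, htx⟩ := mem_loc.1 hxw
  obtain ⟨c, hc⟩ := mem_princ.1 htx
  obtain ⟨t', ht', htb⟩ := mem_loc.1 hbw
  obtain ⟨d, hd⟩ := mem_princ.1 htb
  have e1 : t * t' * s * y = w * (w * c * d) := by
    rw [mul_assoc (t * t'), hb, mul_mul_mul_comm, hc, hd, mul_mul_mul_comm, mul_assoc, mul_assoc]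
  have h1 : w * c * d ∈ loc M (r.princ y) := hy.mem_of_pow_mem (n := 2) <| le_loc M _ <| by
    have : (w * c * d) ^ 2 = t * t' * s * y * (c * d) := by
      rw [e1, sq]
      ac_rfl
    rw [this]
    exact mul_mem_right (mul_mem_left _ (mem_princ_self y)) _
  obtain ⟨q, hq, hqy⟩ := mem_loc.1 h1
  obtain ⟨e, he⟩ := mem_princ.1 hqy
  have hwM : w ∉ M.1 := fun hwM => by
    have e2 : y * (q * (t * t' * s)) = y * (w * e) := by
      calc y * (q * (t * t' * s)) = q * (t * t' * s * y) := by rw [mul_left_comm, mul_comm y]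
        _ = w * (y * e) := by rw [e1, mul_left_comm, he]
        _ = y * (w * e) := mul_left_comm _ _ _
    have e3 := mul_left_cancel_of_nonzero r hy0 e2
    exact mul_notMem_max M hq (mul_notMem_max M (mul_notMem_max M ht ht') hs)
      (e3 ▸ mul_mem_right hwM e)
  have hbM : b ∉ M.1 := fun hbM => (maxSpectrum_isPrime M).pow_notMem hwM n
    (sup_le (princ_le.2 hx) (princ_le.2 hbM) hwn)
  refine mem_loc.2 ⟨b, hbM, ?_⟩
  rw [mul_comm, ← hb]
  exact mul_mem_left s (mem_princ_self y)

/-- A local generator `p` of some radical generates `M` locally: a common divisor `q ∈ M` of `p` and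
`w ∈ M` divides `p`, so `p` divides `q` and with it `w`. -/
theorem isAlmostDedekind_of_isInvertible_rad : r.IsAlmostDedekind := ⟨fun M => by
  have hrad : ∀ x ∈ M.1, x ∉ zeroElements H → ∃ p ∈ M.1, p ∉ zeroElements H ∧
      (loc M (r.princ p)).IsRadical ∧ ∃ n : ℕ, p ^ n ∈ r.princ x := fun x hx hx0 => by
    obtain ⟨p, hp, hp0, hle⟩ := exists_le_loc_princ M
      (h _ (princ_ne_bot hx0) (isCompactElement_princ x))
    obtain ⟨n, -, hn⟩ := mem_rad.1 hp
    exact ⟨p, rad_le (maxSpectrum_isPrime M).isRadical (princ_le.2 hx) hp, hp0,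
      isRadical_loc_princ (isRadical_rad _) hp hle, n, hn⟩
  obtain ⟨x, hx, hx0⟩ := ne_bot_iff.1 (maxSpectrum_ne_bot M)
  obtain ⟨p, hp, hp0, hpr, -⟩ := hrad x hx hx0
  have hMp : M.1 ≤ loc M (r.princ p) := fun w hw => by
    obtain ⟨q, hq0, hpq, hwq, n, -, hn⟩ := exists_common_divisor h M (v := w) hp0
    have hqM : q ∈ M.1 := (maxSpectrum_isPrime M).isRadical.mem_of_pow_mem
      (sup_le (princ_le.2 hp) (princ_le.2 hw) hn)
    exact loc_le_loc_iff.2 (princ_le.2 (mem_loc_princ_of_mem_loc_princ h hqM hp0 hpr hpq)) hwq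
  refine isDiscreteAt_of_pow_mem hp hMp fun x hx0 => ?_
  by_cases hx : x ∈ M.1
  · obtain ⟨q, hq, hq0, hqr, n, hn⟩ := hrad x hx hx0
    have hpq := mem_loc_princ_of_mem_loc_princ h hp hq0 hqr (hMp hq)
    refine ⟨n, le_loc_trans (pow_le_loc (princ_le.2 hpq) n) ?_ (pow_mem_pow (mem_princ_self p) n)⟩
    rw [← princ_pow]
    exact (princ_le.2 hn).trans (le_loc M _)
  · exact ⟨0, mem_loc_of_notMem hx (mem_princ_self x)⟩⟩

theorem hasCompactRadicals_of_isInvertible_rad : r.HasCompactRadicals :=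
  hasCompactRadicals_of_forall_exists_isInvertible fun M => by
    obtain ⟨x, hx, hx0⟩ := ne_bot_iff.1 (maxSpectrum_ne_bot M)
    exact ⟨rad (r.princ x), rad_le (maxSpectrum_isPrime M).isRadical (princ_le.2 hx),
      h _ (princ_ne_bot hx0) (isCompactElement_princ x), isRadical_rad _⟩

end Radicals

end WeakIdealSystem

/-! ### Factorization of upper semicontinuous functions -/

namespace USCFun

variable {X : Type u} [TopologicalSpace X]

theorem mul_apply (f g : USCFun X) (x : X) : (f * g).1 x = f.1 x + g.1 x := rfl

theorem pow_apply (f : USCFun X) (n : ℕ) (x : X) : (f ^ n).1 x = n * f.1 x := by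
  induction n with
  | zero => rw [pow_zero, zero_mul]; rfl
  | succ n ih => rw [pow_succ, mul_apply, ih, add_mul, one_mul]

theorem mul_left_cancel' {f g h : USCFun X} (H : f * g = f * h) : g = h :=
  Subtype.ext <| funext fun x => Nat.add_left_cancel (congrArg (fun k : USCFun X => k.1 x) H)

/-- The indicator function of `{x | i < f x}`. -/
def level (f : USCFun X) (i : ℕ) : USCFun X :=
  ⟨fun x => if i < f.1 x then 1 else 0, by
    intro x k hk
    by_cases h : i < f.1 x
    · refine Filter.Eventually.of_forall fun y => lt_of_le_of_lt ?_ hk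
      simp only [if_pos h]
      split_ifs <;> simp
    · filter_upwards [f.2.1 x (i + 1) (by omega)] with y hy
      have hy' : ¬ i < f.1 y := by omega
      simpa only [if_neg h, if_neg hy'] using hk, by
    refine f.2.2.mono' fun x hx => subset_tsupport _ fun h => hx ?_
    simp [h]⟩

theorem level_apply (f : USCFun X) (i : ℕ) (x : X) :
    (level f i).1 x = if i < f.1 x then 1 else 0 := rfl

theorem level_le_level (f : USCFun X) {i j : ℕ} (h : i ≤ j) : level f i ≤ level f j := fun x => by
  rw [level_apply, level_apply]
  split_ifs <;> omega

/-- A level function has values `0` and `1` only, and `n * g x ≥ 1` forces `g x ≥ 1`. This becomes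
radicality of the corresponding `r`-ideal. -/
theorem le_level_of_pow_le {f g : USCFun X} {i n : ℕ} (h : g ^ n ≤ level f i) :
    g ≤ level f i := fun x => by
  have hx := h x
  rw [pow_apply] at hx
  rw [level_apply] at hx ⊢
  split_ifs at hx ⊢ with h1
  · exact Nat.one_le_iff_ne_zero.2 fun h0 => by simp [h0] at hx
  · exact Nat.zero_le _

theorem prod_map_level_apply (f : USCFun X) (n : ℕ) (x : X) :
    ((List.range n).map (level f)).prod.1 x = min (f.1 x) n := by
  induction n with
  | zero => simp; rfl
  | succ n ih =>
    rw [List.range_succ, List.map_append, List.prod_append, mul_apply, ih, List.map_singleton,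
      List.prod_singleton, level_apply]
    split_ifs <;> omega

/-- Upper semicontinuous functions are bounded above on compact sets, so finitely many levels
suffice. -/
theorem exists_prod_map_level_eq (f : USCFun X) :
    ∃ n, ((List.range n).map (level f)).prod = f := by
  obtain ⟨n, hn⟩ := UpperSemicontinuousOn.bddAbove_of_isCompact f.2.2
    (f.2.1.upperSemicontinuousOn _)
  refine ⟨n, Subtype.ext (funext fun x => ?_)⟩
  rw [prod_map_level_apply, min_eq_left]
  by_cases hx : x ∈ tsupport f.1
  · exact hn ⟨x, hx, rfl⟩
  · rw [image_eq_zero_of_notMem_tsupport hx]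
    exact Nat.zero_le n

end USCFun

/-! ### Unique ascending radical factorizations -/

namespace WeakIdealSystem

variable {H : Type u} [CommMonoid H] {r : WeakIdealSystem H}

theorem prod_filter_ne_one (l : List r.RIdeal) [DecidablePred fun J : r.RIdeal => J ≠ 1] :
    (l.filter (fun J => J ≠ 1)).prod = l.prod := by
  induction l with
  | nil => rfl
  | cons J l ih =>
    by_cases hJ : J = 1
    · rw [List.filter_cons_of_neg (by simpa using hJ), ih, List.prod_cons, hJ, one_mul]
    · rw [List.filter_cons_of_pos (by simpa using hJ), List.prod_cons, ih, List.prod_cons]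

theorem eq_nil_of_one_le_prod {l : List r.RIdeal} (hl : ∀ J ∈ l, J ≠ 1) (h : 1 ≤ l.prod) :
    l = [] := by
  cases l with
  | nil => rfl
  | cons J l =>
    exact absurd ((le_one J).antisymm (h.trans (prod_le_of_mem (by simp)))) (hl J (by simp))

/-- Ascending factorizations into proper radical ideals are unique in the presence of
cancellation. -/
theorem eq_of_prod_eq (hc : ∀ I A B : r.RIdeal, I ≠ ⊥ → I * A = I * B → A = B)
    {l l' : List r.RIdeal} (hl : ∀ J ∈ l, J ≠ 1 ∧ J.IsRadical) (hl' : ∀ J ∈ l', J ≠ 1 ∧ J.IsRadical)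
    (hp : l.Pairwise (· ≤ ·)) (hp' : l'.Pairwise (· ≤ ·)) (hb : l.prod ≠ ⊥)
    (h : l.prod = l'.prod) : l = l' := by
  induction l generalizing l' with
  | nil => exact (eq_nil_of_one_le_prod (fun J hJ => (hl' J hJ).1) h.le).symm
  | cons J l ih =>
    cases l' with
    | nil => exact eq_nil_of_one_le_prod (fun J hJ => (hl J hJ).1) h.ge
    | cons J' l' =>
      -- The first factor `A` is the smallest, so a power of it lies below the product and hence in
      -- any radical `B` above the product. Thus the first factors agree and cancel.
      have key : ∀ {A B : r.RIdeal} {m n : List r.RIdeal}, (A :: m).Pairwise (· ≤ ·) →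
          B.IsRadical → (A :: m).prod = (B :: n).prod → A ≤ B := fun hA hB hAB =>
        hB.le_of_pow_le ((pow_length_le_prod fun C hC => by
          rcases List.mem_cons.1 hC with rfl | hC
          exacts [le_rfl, List.rel_of_pairwise_cons hA hC]).trans
            (hAB.le.trans (prod_le_of_mem (by simp))))
      obtain rfl : J = J' := le_antisymm (key hp (hl' J' (by simp)).2 h)
        (key hp' (hl J (by simp)).2 h.symm)
      rw [List.prod_cons] at hb
      rw [List.prod_cons, List.prod_cons] at h
      rw [ih (fun K hK => hl K (by simp [hK])) (fun K hK => hl' K (by simp [hK])) hp.of_cons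
        hp'.of_cons (fun h0 => hb (le_bot_iff.1 (h0 ▸ mul_le_right _ _)))
        (hc J _ _ (fun h0 => hb (le_bot_iff.1 (h0 ▸ mul_le_left _ _))) h)]

theorem existsUnique_radical_factorization (φ : r.RIdeal ≃*o UBot r.MaxSpectrum) {I : r.RIdeal}
    (hI : I ≠ ⊥) : ∃! l : List r.RIdeal, (∀ J ∈ l, J.IsProper ∧ J.IsRadical) ∧
      l.Pairwise (· ≤ ·) ∧ I = l.prod := by
  classical
  have hle : ∀ A B : r.RIdeal, φ A ≤ φ B ↔ A ≤ B := fun A B => φ.map_le_map_iff'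
  have hs : ∀ f, φ (φ.symm f) = f := fun f => φ.toMulEquiv.apply_symm_apply f
  have hinj : ∀ A B : r.RIdeal, φ A = φ B → A = B := fun A B h =>
    le_antisymm ((hle A B).1 h.le) ((hle B A).1 h.ge)
  have hb : φ ⊥ = 0 := le_antisymm (by
    rw [← hs 0, hle]; exact bot_le) zero_le
  have hcoe : ∀ A : r.RIdeal, A ≠ ⊥ → ∃ f : USCFun r.MaxSpectrum, φ A = f := fun A hA =>
    (WithZero.ne_zero_iff_exists.1 fun h0 => hA (hinj A ⊥ (h0.trans hb.symm))).imp
      fun f hf => hf.symm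
  have hc : ∀ I A B : r.RIdeal, I ≠ ⊥ → I * A = I * B → A = B := fun I A B hI h => by
    obtain ⟨f, hf⟩ := hcoe I hI
    have h' : φ I * φ A = φ I * φ B := by rw [← map_mul, ← map_mul, h]
    by_cases hA : A = ⊥
    · by_contra hAB
      obtain ⟨g, hg⟩ := hcoe B fun hB => hAB (hA.trans hB.symm)
      rw [hA, hb, hf, hg, mul_zero, ← WithZero.coe_mul] at h'
      exact WithZero.coe_ne_zero h'.symm
    by_cases hB : B = ⊥
    · obtain ⟨g, hg⟩ := hcoe A hA
      rw [hB, hb, hf, hg, mul_zero, ← WithZero.coe_mul] at h'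
      exact absurd h' WithZero.coe_ne_zero
    · obtain ⟨g, hg⟩ := hcoe A hA
      obtain ⟨k, hk⟩ := hcoe B hB
      rw [hf, hg, hk, ← WithZero.coe_mul, ← WithZero.coe_mul, WithZero.coe_inj] at h'
      exact hinj A B (by rw [hg, hk, USCFun.mul_left_cancel' h'])
  obtain ⟨f, hf⟩ := hcoe I hI
  obtain ⟨n, hn⟩ := f.exists_prod_map_level_eq
  let ψ : USCFun r.MaxSpectrum → r.RIdeal := fun g => φ.symm (g : UBot r.MaxSpectrum)
  have hψ : ∀ m : List (USCFun r.MaxSpectrum), (m.map ψ).prod = ψ m.prod := by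
    intro m
    induction m with
    | nil =>
      refine hinj _ _ ?_
      rw [hs]
      exact map_one φ
    | cons g m ih =>
      rw [List.map_cons, List.prod_cons, List.prod_cons, ih]
      refine hinj _ _ ?_
      rw [map_mul, hs, hs, hs, WithZero.coe_mul]
  -- Levels not reached by `f` yield the factor `1` and are dropped.
  set l := (((List.range n).map f.level).map ψ).filter (fun J => J ≠ 1)
  have hl : ∀ J ∈ l, J ≠ 1 ∧ J.IsRadical := by
    intro J hJ
    obtain ⟨hJ, hJ1⟩ := List.mem_filter.1 hJ
    refine ⟨by simpa using hJ1, ?_⟩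
    obtain ⟨g, hg, rfl⟩ := List.mem_map.1 hJ
    obtain ⟨i, -, rfl⟩ := List.mem_map.1 hg
    refine isRadical_iff_forall_pow_le.2 fun A k hA => ?_
    by_cases hAb : A = ⊥
    · rw [hAb]; exact bot_le
    · obtain ⟨g, hg⟩ := hcoe A hAb
      rw [← hle, map_pow, hs, hg, ← WithZero.coe_pow, WithZero.coe_le_coe] at hA
      rw [← hle, hs, hg, WithZero.coe_le_coe]
      exact USCFun.le_level_of_pow_le hA
  have hp : l.Pairwise (· ≤ ·) := by
    refine List.Pairwise.filter _ ?_
    rw [List.pairwise_map, List.pairwise_map]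
    refine List.pairwise_le_range.imp fun {i j} hij => ?_
    rw [← hle, hs, hs, WithZero.coe_le_coe]
    exact f.level_le_level hij
  have hprod : I = l.prod := by
    rw [prod_filter_ne_one, hψ, hn]
    exact hinj _ _ (by rw [hf, hs])
  refine ⟨l, ⟨fun J hJ => ⟨isProper_iff.2 (hl J hJ).1, (hl J hJ).2⟩, hp, hprod⟩, ?_⟩
  rintro l' ⟨hl', hp', hprod'⟩
  exact eq_of_prod_eq hc (fun J hJ => ⟨isProper_iff.1 (hl' J hJ).1, (hl' J hJ).2⟩) hl hp' hp
    (hprod' ▸ hI) (hprod'.symm.trans hprod)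

end WeakIdealSystem

/-! ### The equivalence -/

open WeakIdealSystem in
theorem corollary8p5 {H : Type u} [CommMonoid H] [Nontrivial H] (hH : IsCancellativeMonoid H)
    (r : WeakIdealSystem H) (hr : r.IsIdealSystem) (hfin : r.IsFinitary) (hmod : r.IsModular)
    (hne : r.closure ∅ ≠ Set.univ) :
    List.TFAE [
      -- (1)
      r.IsSPMonoid,
      -- (2)
      r.dim ≤ 1 ∧ ∀ I : r.RIdeal, r.IsInvertible I.carrier →
        ∃ l : List r.RIdeal, (∀ J ∈ l, J.IsRadical) ∧ I = l.prod,
      -- (3)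
      r.dim ≤ 1 ∧ ∀ P : r.RIdeal, P.IsPrime → P.IsNontrivial →
        ∃ J : r.RIdeal, J ≤ P ∧ r.IsInvertible J.carrier ∧ J.IsRadical,
      -- (4a)
      ∀ I : r.RIdeal, ∃ l : List r.RIdeal,
        (∀ J ∈ l, J.IsRadical) ∧ l.Pairwise (· ≤ ·) ∧ I = l.prod,
      -- (4b)
      ∀ I : r.RIdeal, I.IsNontrivial → ∃! l : List r.RIdeal,
        (∀ J ∈ l, J.IsProper ∧ J.IsRadical) ∧ l.Pairwise (· ≤ ·) ∧ I = l.prod,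
      -- (5)
      ∀ I : r.RIdeal, I.IsNontrivial → r.IsFinitelyGenerated I.carrier →
        r.IsInvertible I.radical,
      -- (6)
      Nonempty (r.RIdeal ≃*o UBot r.MaxSpectrum),
      -- (7)
      r.IsPruferMonoid ∧ ∀ I : r.RIdeal, r.IsFinitelyGenerated I.carrier →
        r.IsFinitelyGenerated I.radical] := by
  have : r.IsCancellativeSystem := ⟨inferInstance, hH, hr, hfin, hne⟩
  have : IsModularLattice r.RIdeal := isModularLattice_of_isModular hmod
  -- Entries 4 and 5 are the two forms of ascending factorization, 6 is invertibility of radicals, 7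
  -- the isomorphism and 8 the Prüfer condition.
  tfae_have 1 → 2 := fun h => by
    have := h.isAlmostDedekind
    exact ⟨dim_le_one, fun I _ => h I⟩
  tfae_have 2 → 3 := fun h => ⟨h.1, fun P hP hb =>
    exists_isInvertible_isRadical_le h.2 hP (isNontrivial_iff.1 hb)⟩
  tfae_have 3 → 7 := fun h => by
    have hM : ∀ M : r.MaxSpectrum, ∃ J : r.RIdeal, J ≤ M.1 ∧ r.IsInvertible J.carrier ∧
        J.IsRadical := fun M => h.2 M.1 (maxSpectrum_isPrime M) M.2.1
    have := isAlmostDedekind_of_dim_le_one h.1 hM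
    have := hasCompactRadicals_of_forall_exists_isInvertible hM
    exact nonempty_orderMonoidIso r
  tfae_have 7 → 5 := fun ⟨φ⟩ I hI => existsUnique_radical_factorization φ (isNontrivial_iff.1 hI)
  tfae_have 5 → 4 := fun h I => by
    by_cases hI : I = ⊥
    -- `⊥` is prime, hence radical, and is its own factorization.
    · exact ⟨[I], by simpa [hI] using isPrime_bot.isRadical, by simp, by simp⟩
    · obtain ⟨l, ⟨hl, hp, hIl⟩, -⟩ := h I (isNontrivial_iff.2 hI)
      exact ⟨l, fun J hJ => (hl J hJ).2, hp, hIl⟩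
  tfae_have 4 → 1 := fun h I => by
    obtain ⟨l, hl, -, hIl⟩ := h I
    exact ⟨l, hl, hIl⟩
  tfae_have 1 → 8 := fun h => by
    have := h.isAlmostDedekind
    have := h.hasCompactRadicals
    refine ⟨fun I ⟨x, hx, hxr⟩ hI => isInvertible_of_isCompactElement
      (isFinitelyGenerated_iff.1 hI) (ne_bot_of_mem hx (isRegularElement_iff.1 hxr)),
      fun I hI => isFinitelyGenerated_iff (I := rad I).2 ?_⟩
    have hI := isFinitelyGenerated_iff.1 hI
    by_cases hb : I = ⊥
    · have h0 : rad I = I := le_antisymm (rad_le (hb ▸ isPrime_bot.isRadical) le_rfl) (le_rad I)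
      rwa [h0]
    · exact isCompactElement_of_isInvertible (isInvertible_rad hI hb)
  tfae_have 8 → 6 := fun h I hI hfg => by
    obtain ⟨x, hx, hx0⟩ := ne_bot_iff.1 (isNontrivial_iff.1 hI)
    exact h.1 (rad I) ⟨x, le_rad I hx, isRegularElement_iff.2 hx0⟩ (h.2 I hfg)
  tfae_have 6 → 7 := fun h => by
    have h' : ∀ I : r.RIdeal, I ≠ ⊥ → IsCompactElement I → r.IsInvertible (rad I).carrier :=
      fun I hI hc => h I (isNontrivial_iff.2 hI) (isFinitelyGenerated_iff.2 hc)
    have := isAlmostDedekind_of_isInvertible_rad h'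
    have := hasCompactRadicals_of_isInvertible_rad h'
    exact nonempty_orderMonoidIso r
  tfae_finish
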